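/- Let $\mathfrak g$ be a (finite-dimensional) complex semisimple Lie algebra with Killing form $K$, $\mathfrak h$ a Cartan subalgebra, $\Phi$ the root system of $(\mathfrak g,\mathfrak h)$, $\Phi^+$ a set of positive roots, $\Phi^-=-\Phi^+$, $W$ the Weyl group with identity $e$ and reflections $s_\beta$, $\mathfrak g_\alpha$ the root spaces, $\mathfrak n=\bigoplus_{\alpha\in\Phi^+}\mathfrak g_\alpha$, $\mathfrak n_-=\bigoplus_{\alpha\in\Phi^+}\mathfrak g_{-\alpha}$, and $H_\alpha\in[\mathfrak g_\alpha,\mathfrak g_{-\alpha}]$ the coroot, $\alpha(H_\alpha)=2$. For $w\in W$ put $\Phi_w=\{\alpha\in\Phi^+ : w^{-1}\alpha\in\Phi^-\}$, $w\cdot\mathfrak n=\bigoplus_{\alpha\in\Phi^+}\mathfrak g_{w\alpha}$ and $w\cdot\mathfrak n_-=\bigoplus_{\alpha\in\Phi^+}\mathfrak g_{-w\alpha}$. For every $\alpha\in\Phi$ choose a nonzero $E_\alpha\in\mathfrak g_\alpha$ (for instance from a Chevalley basis), and let $$\pi=\sum_{\alpha\in\Phi^+}\frac{1}{K(E_\alpha,E_{-\alpha})}\,E_\alpha\wedge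 E_{-\alpha}\in\mathfrak g\wedge\mathfrak g .$$ For a root $\gamma$ let $[E_\gamma,\pi]$ be the image of $\pi$ under the adjoint action of $E_\gamma$, and let $\mathfrak u_\gamma:=[E_\gamma,\pi]^\sharp\mathfrak g^*$, where $R^\sharp:\mathfrak g^*\to\mathfrak g$ is given by $\langle R^\sharp(\lambda),\mu\rangle=R(\lambda,\mu)$. A root $\beta$ is long if no root $\alpha$ in its irreducible component satisfies $(\beta,\beta)<(\alpha,\alpha)$. Fix $c\in\mathbb C^\times$ and put $\langle(x_1,y_1),(x_2,y_2)\rangle=c\,K(x_1,x_2)-c\,K(y_1,y_2)$ on $\mathfrak g\oplus\mathfrak g$. For a subspace $U\subseteq\mathfrak g$ let $U_\Delta=\{(x,x):x\in U\}$ and $U_{-\Delta}=\{(x,-x):x\in U\}$. Identify $\mathfrak g$ with $\mathfrak g_\Delta$ and, through this form, $\mathfrak g^*$ with the subalgebra $\mathfrak h_{-\Delta}+(\mathfrak n,0)+(0,\mathfrak n_-)$ (the standard Lie bialgebra structure on $\mathfrak g$). For a subspace $\mathfrak m\subseteq\mathfrak g$ let $\mathfrak m^\perp\subseteq\mathfrak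 g^*$ be its annihilator; $\mathfrak m$ is a coisotropic subalgebra if $\mathfrak m$ is a subalgebra of $\mathfrak g$ and $\mathfrak m^\perp$ a subalgebra of $\mathfrak g^*$. For a subspace $V\subseteq\mathfrak h$ with Killing-orthogonal $V^{\perp}$ in $\mathfrak h$, and $u,v\in W$, let $$\mathfrak l_{V,u,v}=V_\Delta+(V^{\perp})_{-\Delta}+(u\cdot\mathfrak n,0)+(0,v\cdot\mathfrak n_-).$$ **Theorem.** If $\beta\in\Phi^+$ is a long root, then $$\mathfrak u_\beta=\mathbb C H_\beta\oplus\bigoplus_{\alpha\in\Phi_{s_\beta}}\mathfrak g_\alpha,\qquad \mathfrak u_{-\beta}=\mathbb C H_\beta\oplus\bigoplus_{\alpha\in\Phi_{s_\beta}}\mathfrak g_{-\alpha},$$ and these are special cases, with $(u,v)=(e,s_\beta)$ and $(u,v)=(s_\beta,e)$ respectively and $V=\mathbb C H_\beta$, of the coisotropic subalgebras $V+\bigoplus_{\alpha\in\Phi_u}\mathfrak g_{-\alpha}+\bigoplus_{\alpha\in\Phi_v}\mathfrak g_\alpha$ attached to $\mathfrak l_{V,u,v}$ for $\Phi_u\cap\Phi_v=\emptyset$.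 That is: $\Phi_e\cap\Phi_{s_\beta}=\emptyset$; $\mathfrak u_\beta$ and $\mathfrak u_{-\beta}$ have this form for the indicated $V,u,v$ and are coisotropic subalgebras of $\mathfrak g$; and $\mathfrak l_{\mathbb C H_\beta,e,s_\beta}$ and $\mathfrak l_{\mathbb C H_\beta,s_\beta,e}$ are Lagrangian subalgebras of $\mathfrak g\oplus\mathfrak g$ (subalgebras of dimension $\dim\mathfrak g$ that are isotropic for $\langle\,,\rangle$) with $$\mathfrak l_{\mathbb C H_\beta,e,s_\beta}=(\mathfrak u_\beta)_\Delta\oplus\mathfrak u_\beta^\perp,\qquad \mathfrak l_{\mathbb C H_\beta,s_\beta,e}=(\mathfrak u_{-\beta})_\Delta\oplus\mathfrak u_{-\beta}^\perp .$$ -/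

import Mathlib

open scoped TensorProduct

noncomputable section

namespace ZambonCoisotropic

open Module LieAlgebra LieAlgebra.IsKilling

variable {𝔤 : Type*} [LieRing 𝔤] [LieAlgebra ℂ 𝔤]

/-! ### Bivectors -/

/-- The bivector `x ∧ y`, as the antisymmetric tensor `x ⊗ y - y ⊗ x`. -/
def wedge (x y : 𝔤) : 𝔤 ⊗[ℂ] 𝔤 := x ⊗ₜ[ℂ] y - y ⊗ₜ[ℂ] x

/-- For `R ∈ 𝔤 ⊗ 𝔤`, the linear map `R^♯ : 𝔤* → 𝔤` with `⟨R^♯(f), g⟩ = R(f, g)`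
(see `sharp_spec`). -/
def sharp (R : 𝔤 ⊗[ℂ] 𝔤) : Dual ℂ 𝔤 →ₗ[ℂ] 𝔤 :=
  dualTensorHom ℂ (Dual ℂ 𝔤) 𝔤 ((Dual.eval ℂ 𝔤).rTensor 𝔤 R)

theorem sharp_tmul (x y : 𝔤) (f : Dual ℂ 𝔤) : sharp (x ⊗ₜ[ℂ] y) f = f x • y := by
  simp [sharp]

theorem sharp_spec (R : 𝔤 ⊗[ℂ] 𝔤) (f g : Dual ℂ 𝔤) :
    g (sharp R f) = TensorProduct.dualDistrib ℂ 𝔤 𝔤 (f ⊗ₜ[ℂ] g) R := by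
  induction R with
  | zero => simp [sharp]
  | tmul x y => simp [sharp_tmul]
  | add a b ha hb =>
    have h : sharp (a + b) f = sharp a f + sharp b f := by simp [sharp]
    rw [h, map_add, map_add, ha, hb]

/-- `U = A ⊕ (⊕ i, F i)` as an internal direct sum of subspaces. -/
def IsInternalDirectSum {ι : Type*} (U A : Submodule ℂ 𝔤) (F : ι → Submodule ℂ 𝔤) : Prop :=
  U = A ⊔ ⨆ i, F i ∧ Disjoint A (⨆ i, F i) ∧ iSupIndep F

/-! ### Subspaces of the double `𝔤 ⊕ 𝔤` -/

/-- `U_Δ = {(x, x) | x ∈ U}`. -/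
def diag (U : Submodule ℂ 𝔤) : Submodule ℂ (𝔤 × 𝔤) :=
  U.map (LinearMap.prod LinearMap.id LinearMap.id)

/-- `U_{-Δ} = {(x, -x) | x ∈ U}`. -/
def antidiag (U : Submodule ℂ 𝔤) : Submodule ℂ (𝔤 × 𝔤) :=
  U.map (LinearMap.prod LinearMap.id (-LinearMap.id))

/-- The form `⟨(x₁, y₁), (x₂, y₂)⟩ = c K(x₁, x₂) - c K(y₁, y₂)` on `𝔤 ⊕ 𝔤`, `K` the Killing form. -/
def doubleForm (c : ℂ) : LinearMap.BilinForm ℂ (𝔤 × 𝔤) :=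
  c • ((killingForm ℂ 𝔤).compl₁₂ (LinearMap.fst ℂ 𝔤 𝔤) (LinearMap.fst ℂ 𝔤 𝔤) -
    (killingForm ℂ 𝔤).compl₁₂ (LinearMap.snd ℂ 𝔤 𝔤) (LinearMap.snd ℂ 𝔤 𝔤))

theorem doubleForm_apply (c : ℂ) (p q : 𝔤 × 𝔤) :
    doubleForm c p q = c * killingForm ℂ 𝔤 p.1 q.1 - c * killingForm ℂ 𝔤 p.2 q.2 := by
  simp [doubleForm, mul_sub]

/-- The subspace `U` of a Lie algebra is a Lie subalgebra. -/
def IsSubalgebra {L : Type*} [LieRing L] [LieAlgebra ℂ L] (U : Submodule ℂ L) : Prop :=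
  ∀ x ∈ U, ∀ y ∈ U, ⁅x, y⁆ ∈ U

/-- `l` is a Lagrangian subalgebra of the `2 dim 𝔤`-dimensional Lie algebra `𝔤 ⊕ 𝔤`. -/
def IsLagrangian (c : ℂ) (l : Submodule ℂ (𝔤 × 𝔤)) : Prop :=
  IsSubalgebra l ∧ finrank ℂ l = finrank ℂ 𝔤 ∧ ∀ p ∈ l, ∀ q ∈ l, doubleForm c p q = 0

/-- The functional on `𝔤 ≅ 𝔤_Δ` defined by an element of `𝔤 ⊕ 𝔤`: `p ↦ (z ↦ ⟨p, (z, z)⟩)`. -/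
def toDual (c : ℂ) : 𝔤 × 𝔤 →ₗ[ℂ] Dual ℂ 𝔤 :=
  (doubleForm c).compl₂ (LinearMap.prod LinearMap.id LinearMap.id)

theorem toDual_apply (c : ℂ) (p : 𝔤 × 𝔤) (z : 𝔤) : toDual c p z = doubleForm c p (z, z) := rfl

variable [FiniteDimensional ℂ 𝔤] [LieAlgebra.IsSemisimple ℂ 𝔤]
  {𝔥 : LieSubalgebra ℂ 𝔤} [𝔥.IsCartanSubalgebra]

/-! ### Roots -/

/-- The root space `𝔤_α`. -/
def rootSubspace (α : 𝔥.root) : Submodule ℂ 𝔤 := (rootSpace 𝔥 α.1).toSubmodule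

/-- The root `-α`. -/
def negRoot (α : 𝔥.root) : 𝔥.root := ⟨-α.1, by
  have h := α.2
  simp only [LieSubalgebra.root, Finset.mem_filter, Finset.mem_univ, true_and] at h ⊢
  exact h.neg⟩

/-- The line `ℂ H_β`, where `H_β ∈ [𝔤_β, 𝔤_{-β}]` is the coroot, `β(H_β) = 2`. -/
def corootLine (β : 𝔥.root) : Submodule ℂ 𝔤 := ℂ ∙ ((coroot β.1 : 𝔥) : 𝔤)

/-- The form on the roots dual to the Killing form, `(α, γ) = K(t_α, t_γ)`, where `t_α ∈ 𝔥` is the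
element with `K(t_α, h) = α(h)` for all `h ∈ 𝔥`. -/
def rootInner (α γ : 𝔥.root) : ℂ :=
  killingForm ℂ 𝔤 ((cartanEquivDual 𝔥).symm α.1.toLinear : 𝔥)
    ((cartanEquivDual 𝔥).symm γ.1.toLinear : 𝔥)

/-- Two roots lie in the same irreducible component of the root system: they are joined by a chain
of roots in which neighbours are not orthogonal. -/
def SameComponent (α γ : 𝔥.root) : Prop :=
  Relation.ReflTransGen (fun x y : 𝔥.root => rootInner x y ≠ 0) α γ

/-- `β` is a long root: no root `α` in the irreducible component of `β` satisfies
`(β, β) < (α, α)`. The numbers `(α, α)` are real. -/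
def IsLongRoot (β : 𝔥.root) : Prop :=
  ∀ α : 𝔥.root, SameComponent β α → ¬ (rootInner β β).re < (rootInner α α).re

variable (b : (rootSystem 𝔥).Base)

/-- `Φ_w = {α ∈ Φ⁺ | w⁻¹ α ∈ Φ⁻}`, where `Φ⁺` is the set of positive roots for the base `b` and
`Φ⁻ = -Φ⁺`. -/
def inversionSet (w : (rootSystem 𝔥).weylGroup) : Set 𝔥.root :=
  {α | b.IsPos α ∧ b.IsPos (negRoot ((rootSystem 𝔥).weylGroupToPerm w⁻¹ α))}

/-- The reflection `s_β` as an element of the Weyl group. -/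
abbrev reflectionElt (β : 𝔥.root) : (rootSystem 𝔥).weylGroup :=
  RootPairing.weylGroup.ofIdx (rootSystem 𝔥) β

/-- `w · 𝔫`, the sum of the root spaces `𝔤_{w α}` over the positive roots `α`. -/
def nPos (w : (rootSystem 𝔥).weylGroup) : Submodule ℂ 𝔤 :=
  ⨆ α : {α : 𝔥.root // b.IsPos α}, rootSubspace ((rootSystem 𝔥).weylGroupToPerm w α.1)

/-- `w · 𝔫₋`, the sum of the root spaces `𝔤_{w (-α)}` over the positive roots `α`. -/
def nNeg (w : (rootSystem 𝔥).weylGroup) : Submodule ℂ 𝔤 :=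
  ⨆ α : {α : 𝔥.root // b.IsPos α}, rootSubspace ((rootSystem 𝔥).weylGroupToPerm w (negRoot α.1))

/-! ### The subspaces `𝔲_β` and `𝔲_{-β}` -/

open Classical in
/-- `π = ∑_{α ∈ Φ⁺} λ_α E_α ∧ E_{-α}` with `λ_α = 1 / K(E_α, E_{-α})`. -/
def bivector (E : 𝔥.root → 𝔤) : 𝔤 ⊗[ℂ] 𝔤 :=
  ∑ α : 𝔥.root with b.IsPos α,
    (1 / killingForm ℂ 𝔤 (E α) (E (negRoot α))) • wedge (E α) (E (negRoot α))

/-- `𝔲_γ = [E_γ, π]^♯ 𝔤*`; the bracket is the adjoint action of `𝔤` on `𝔤 ⊗ 𝔤`. -/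
def zambon (E : 𝔥.root → 𝔤) (γ : 𝔥.root) : Submodule ℂ 𝔤 :=
  LinearMap.range (sharp ⁅E γ, bivector b E⁆)

/-! ### The standard Lie bialgebra structure and coisotropic subalgebras -/

/-- The Lie subalgebra `𝔥_{-Δ} + (𝔫, 0) + (0, 𝔫₋)` of `𝔤 ⊕ 𝔤`. Together with `𝔤_Δ` it forms the
standard Manin triple; `toDual c` identifies it with `𝔤*`, and its bracket is the Lie bracket on
`𝔤*` of the standard Lie bialgebra structure of `𝔤`. -/
def dualSubalgebra : Submodule ℂ (𝔤 × 𝔤) :=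
  antidiag 𝔥.toSubmodule ⊔ (nPos b 1).prod ⊥ ⊔ (⊥ : Submodule ℂ 𝔤).prod (nNeg b 1)

/-- The annihilator of `m` in `𝔤* ≅ 𝔥_{-Δ} + (𝔫, 0) + (0, 𝔫₋)`. -/
def annihilator (c : ℂ) (m : Submodule ℂ 𝔤) : Submodule ℂ (𝔤 × 𝔤) :=
  dualSubalgebra b ⊓ m.dualAnnihilator.comap (toDual c)

/-- `m` is a coisotropic subalgebra of `𝔤` for the standard Lie bialgebra structure: `m` is a
subalgebra of `𝔤` and its annihilator is a subalgebra of `𝔤*`. -/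
def IsCoisotropic (c : ℂ) (m : Submodule ℂ 𝔤) : Prop :=
  IsSubalgebra m ∧ IsSubalgebra (annihilator b c m)

/-- `l` is a Lagrangian subalgebra of `𝔤 ⊕ 𝔤` of the form `l = m_Δ ⊕ m^⊥` with `m` the
coisotropic subalgebra of `𝔤` corresponding to `l`. -/
def IsCoisotropicLagrangian (c : ℂ) (l : Submodule ℂ (𝔤 × 𝔤)) (m : Submodule ℂ 𝔤) : Prop :=
  IsLagrangian c l ∧ IsCoisotropic b c m ∧
    l = diag m ⊔ annihilator b c m ∧ Disjoint (diag m) (annihilator b c m)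

variable (𝔥) in
/-- The orthogonal `V^⊥` in `𝔥` for the Killing form. -/
def cartanPerp (V : Submodule ℂ 𝔤) : Submodule ℂ 𝔤 :=
  𝔥.toSubmodule ⊓ (killingForm ℂ 𝔤).orthogonal V

/-- `𝔩_{V,u,v} = V_Δ + (V^⊥)_{-Δ} + (u · 𝔫, 0) + (0, v · 𝔫₋)`, for a subspace `V` of `𝔥`. -/
def lagr (V : Submodule ℂ 𝔤) (u v : (rootSystem 𝔥).weylGroup) : Submodule ℂ (𝔤 × 𝔤) :=
  diag V ⊔ antidiag (cartanPerp 𝔥 V) ⊔ (nPos b u).prod ⊥ ⊔ (⊥ : Submodule ℂ 𝔤).prod (nNeg b v)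

/-- `V + ⊕_{α ∈ Φ_u} 𝔤_{-α} + ⊕_{α ∈ Φ_v} 𝔤_α`, for a subspace `V` of `𝔥`. -/
def coisotropicFamily (V : Submodule ℂ 𝔤) (u v : (rootSystem 𝔥).weylGroup) : Submodule ℂ 𝔤 :=
  V ⊔ (⨆ α : inversionSet b u, rootSubspace (negRoot α.1)) ⊔
    ⨆ α : inversionSet b v, rootSubspace α.1

end ZambonCoisotropic

end

set_option linter.unusedSectionVars false
open scoped TensorProduct

noncomputable section

namespace ZambonCoisotropic

open Module LieAlgebra LieAlgebra.IsKilling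

variable {𝔤 : Type*} [LieRing 𝔤] [LieAlgebra ℂ 𝔤] [FiniteDimensional ℂ 𝔤]
  [LieAlgebra.IsSemisimple ℂ 𝔤] {𝔥 : LieSubalgebra ℂ 𝔤} [𝔥.IsCartanSubalgebra]

/-! ### Sums of root spaces -/

/-! Identify `𝔤*` with `𝔤` through the Killing form. Then `π^♯` becomes the operator `r` that is `0`
on `𝔥`, `-1` on `𝔫` and `+1` on `𝔫₋`, and by invariance `[x, π]^♯` becomes the commutator of `ad x`
with `r` (`sharp_lie_killingForm`). On the weight space of weight `μ`, `[E_β, π]^♯` is therefore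
`(r_μ - r_{β+μ}) ad E_β`. This scalar can only matter for `μ = 0`, which produces `𝔤_β`; for `μ =
-β`, which produces `ℂ H_β`; and for negative roots `μ` with `β + μ` a positive root, which produce
`𝔤_{β+μ}`.

Length enters when these roots are compared with `Φ_{s_β}`. For `β` long, every root other than `±β`
pairs with the coroot of `β` to `0` or `±1` (`IsLongRoot.apply_coroot_mem`). Hence a root `β + μ` is
sent by `s_β` to `μ`, and a positive root `α ≠ β` with `s_β α` negative must equal `β + s_β α`
(`IsLongRoot.reflectionPerm_notMem_iff`). All of this uses only that `Φ⁺` is closed under addition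
and contains one of each pair `±α`; applied to `Φ⁻`, which replaces `π` by `-π`, it also gives
`𝔲_{-β}`.

The Lagrangian part holds for every `𝔩_{V,u,v}` with `𝔥 = V + V^⊥` and `Φ_u ∩ Φ_v = ∅`
(`isCoisotropicLagrangian_lagr`). Such an `𝔩` is an isotropic subalgebra; together with the
isotropic subspace obtained by swapping `V` with `V^⊥` and passing to opposite roots it spans the
double, so both have dimension `dim 𝔤`. Disjointness of the inversion sets gives `𝔩 = 𝔪_Δ + 𝔩 ∩ 𝔤*`,
and self-orthogonality of `𝔩` identifies `𝔩 ∩ 𝔤*` with `𝔪^⊥`. -/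

theorem root_ext {α γ : 𝔥.root} (h : (α.1 : 𝔥 → ℂ) = γ.1) : α = γ :=
  Subtype.ext (DFunLike.coe_injective h)

theorem root_coe_ne_zero (α : 𝔥.root) : (α.1 : 𝔥 → ℂ) ≠ 0 :=
  LieSubalgebra.isNonZero_coe_root α

@[simp]
theorem coe_negRoot (α : 𝔥.root) : ((negRoot α).1 : 𝔥 → ℂ) = -(α.1 : 𝔥 → ℂ) := rfl

@[simp]
theorem negRoot_negRoot (α : 𝔥.root) : negRoot (negRoot α) = α :=
  root_ext (by simp)

/-- The sum of the root spaces `𝔤_α` over `α ∈ S`. -/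
def rootSum (S : Set 𝔥.root) : Submodule ℂ 𝔤 := ⨆ α : S, rootSubspace α.1

theorem rootSubspace_le_rootSum {S : Set 𝔥.root} {α : 𝔥.root} (h : α ∈ S) :
    rootSubspace α ≤ rootSum S :=
  le_iSup (fun α : S => rootSubspace α.1) ⟨α, h⟩

theorem rootSum_le {S : Set 𝔥.root} {U : Submodule ℂ 𝔤} (h : ∀ α ∈ S, rootSubspace α ≤ U) :
    rootSum S ≤ U :=
  iSup_le fun α => h α.1 α.2

theorem rootSum_mono {S T : Set 𝔥.root} (h : S ⊆ T) : rootSum S ≤ rootSum T :=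
  rootSum_le fun _ hα => rootSubspace_le_rootSum (h hα)

theorem rootSum_union (S T : Set 𝔥.root) : rootSum (S ∪ T) = rootSum S ⊔ rootSum T := by
  refine le_antisymm (rootSum_le ?_) (sup_le (rootSum_mono Set.subset_union_left)
    (rootSum_mono Set.subset_union_right))
  rintro α (h | h)
  · exact (rootSubspace_le_rootSum h).trans le_sup_left
  · exact (rootSubspace_le_rootSum h).trans le_sup_right

theorem iSupIndep_rootSpace :
    iSupIndep fun χ : 𝔥 → ℂ => (rootSpace 𝔥 χ).toSubmodule :=
  LieSubmodule.iSupIndep_toSubmodule.mpr (LieModule.iSupIndep_genWeightSpace ℂ 𝔥 𝔤)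

theorem rootSpace_zero_toSubmodule : (rootSpace 𝔥 (0 : 𝔥 → ℂ)).toSubmodule = 𝔥.toSubmodule := by
  rw [rootSpace_zero_eq ℂ 𝔤 𝔥]; rfl

theorem iSupIndep_rootSubspace : iSupIndep (rootSubspace : 𝔥.root → Submodule ℂ 𝔤) :=
  iSupIndep_rootSpace.comp (f := fun α : 𝔥.root => (α.1 : 𝔥 → ℂ)) fun _ _ h => root_ext h

theorem disjoint_rootSum {S T : Set 𝔥.root} (h : Disjoint S T) :
    Disjoint (rootSum S) (rootSum T) := by
  simpa only [rootSum, iSup_subtype] using iSupIndep_rootSubspace.disjoint_biSup_biSup' h (Set.toFinite S)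

theorem disjoint_cartan_rootSum (S : Set 𝔥.root) : Disjoint 𝔥.toSubmodule (rootSum S) := by
  rw [← rootSpace_zero_toSubmodule]
  refine (iSupIndep_rootSpace (0 : 𝔥 → ℂ)).mono_right (rootSum_le fun α _ => ?_)
  exact le_iSup₂_of_le (f := fun χ (_ : χ ≠ (0 : 𝔥 → ℂ)) => (rootSpace 𝔥 χ).toSubmodule)
    (α.1 : 𝔥 → ℂ) (root_coe_ne_zero α) le_rfl

theorem rootSpace_eq_bot_or (χ : 𝔥 → ℂ) :
    (rootSpace 𝔥 χ).toSubmodule = ⊥ ∨ χ = 0 ∨ ∃ α : 𝔥.root, (α.1 : 𝔥 → ℂ) = χ := by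
  by_cases h : rootSpace 𝔥 χ = ⊥
  · exact .inl (by rw [h]; rfl)
  by_cases h0 : χ = 0
  · exact .inr (.inl h0)
  refine .inr (.inr ⟨⟨⟨χ, h⟩, ?_⟩, rfl⟩)
  simpa [LieModule.Weight.IsNonZero, LieModule.Weight.IsZero] using h0

theorem cartan_sup_rootSum_univ : 𝔥.toSubmodule ⊔ rootSum (Set.univ : Set 𝔥.root) = ⊤ := by
  refine top_le_iff.mp ?_
  have h : ⨆ χ : 𝔥 → ℂ, (rootSpace 𝔥 χ).toSubmodule = ⊤ :=
    LieSubmodule.iSup_toSubmodule_eq_top.mpr (LieModule.iSup_genWeightSpace_eq_top ℂ 𝔥 𝔤)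
  rw [← h]
  refine iSup_le fun χ => ?_
  rcases rootSpace_eq_bot_or χ with h | rfl | ⟨α, rfl⟩
  · rw [h]; exact bot_le
  · rw [rootSpace_zero_toSubmodule]; exact le_sup_left
  · exact (rootSubspace_le_rootSum (Set.mem_univ α)).trans le_sup_right

/-! ### Brackets and the Killing form on root spaces -/

theorem lie_mem_rootSpace {χ ψ : 𝔥 → ℂ} {x y : 𝔤} (hx : x ∈ rootSpace 𝔥 χ)
    (hy : y ∈ rootSpace 𝔥 ψ) : ⁅x, y⁆ ∈ rootSpace 𝔥 (χ + ψ) :=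
  lie_mem_genWeightSpace_of_mem_genWeightSpace hx hy

theorem cartan_lie_rootSubspace {α : 𝔥.root} {h x : 𝔤} (hh : h ∈ 𝔥) (hx : x ∈ rootSubspace α) :
    ⁅h, x⁆ = α.1 ⟨h, hh⟩ • x :=
  lie_eq_smul_of_mem_rootSpace hx ⟨h, hh⟩

theorem cartan_lie_cartan {h k : 𝔤} (hh : h ∈ 𝔥) (hk : k ∈ 𝔥) : ⁅h, k⁆ = 0 :=
  congrArg Subtype.val (trivial_lie_zero 𝔥 𝔥 ⟨h, hh⟩ ⟨k, hk⟩)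

theorem cartan_lie_rootSum {S : Set 𝔥.root} {h x : 𝔤} (hh : h ∈ 𝔥) (hx : x ∈ rootSum S) :
    ⁅h, x⁆ ∈ rootSum S := by
  have : rootSum S ≤ (rootSum S).comap (LieAlgebra.ad ℂ 𝔤 h) := rootSum_le fun α hα x hx => by
    rw [Submodule.mem_comap, ad_apply, cartan_lie_rootSubspace hh hx]
    exact Submodule.smul_mem _ _ (rootSubspace_le_rootSum hα hx)
  exact this hx

/-- A set of roots that is closed under addition and contains exactly one of `α`, `-α` for every
root `α`. -/
structure IsPositiveSet (P : Set 𝔥.root) : Prop where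
  neg_mem_iff : ∀ α, negRoot α ∈ P ↔ α ∉ P
  add_mem : ∀ {α γ δ : 𝔥.root}, α ∈ P → γ ∈ P → (δ.1 : 𝔥 → ℂ) = α.1 + γ.1 → δ ∈ P

theorem IsPositiveSet.add_ne_zero {P : Set 𝔥.root} (hP : IsPositiveSet P) {α γ : 𝔥.root}
    (hα : α ∈ P) (hγ : γ ∈ P) : (α.1 : 𝔥 → ℂ) + γ.1 ≠ 0 := fun h => by
  have : γ = negRoot α := root_ext (by rw [coe_negRoot]; exact eq_neg_of_add_eq_zero_right h)
  exact (hP.neg_mem_iff α).mp (this ▸ hγ) hα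

/-- The complement is `-P`. This symmetry yields `𝔫₋` from `𝔫`, the complementary Lagrangian, and
the case of `-β` from that of `β`. -/
theorem IsPositiveSet.compl {P : Set 𝔥.root} (hP : IsPositiveSet P) : IsPositiveSet Pᶜ where
  neg_mem_iff α := by rw [Set.mem_compl_iff, hP.neg_mem_iff]; rfl
  add_mem {α γ δ} hα hγ h := by
    simp only [Set.mem_compl_iff, ← hP.neg_mem_iff] at *
    exact hP.add_mem hα hγ (by simp only [coe_negRoot, h]; abel)

theorem killingForm_cartan_rootSum {S : Set 𝔥.root} {h x : 𝔤} (hh : h ∈ 𝔥) (hx : x ∈ rootSum S) :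
    killingForm ℂ 𝔤 h x = 0 := by
  have : rootSum S ≤ LinearMap.ker (killingForm ℂ 𝔤 h) := rootSum_le fun α _ x hx =>
    killingForm_apply_eq_zero_of_mem_rootSpace_of_add_ne_zero ℂ 𝔤 𝔥 (α := 0)
      ((rootSpace_zero_toSubmodule (𝔥 := 𝔥)).ge hh) hx (by simp)
  exact this hx

theorem killingForm_rootSum_cartan {S : Set 𝔥.root} {h x : 𝔤} (hh : h ∈ 𝔥) (hx : x ∈ rootSum S) :
    killingForm ℂ 𝔤 x h = 0 := by
  rw [LieModule.traceForm_comm]; exact killingForm_cartan_rootSum hh hx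

theorem killingForm_rootSum {P Q : Set 𝔥.root}
    (hPQ : ∀ α ∈ P, ∀ γ ∈ Q, (α.1 : 𝔥 → ℂ) + (γ.1 : 𝔥 → ℂ) ≠ 0) {x y : 𝔤}
    (hx : x ∈ rootSum P) (hy : y ∈ rootSum Q) : killingForm ℂ 𝔤 x y = 0 := by
  have h1 : ∀ α ∈ P, ∀ x ∈ rootSubspace α, rootSum Q ≤ LinearMap.ker (killingForm ℂ 𝔤 x) :=
    fun α hα x hx => rootSum_le fun γ hγ y hy =>
      killingForm_apply_eq_zero_of_mem_rootSpace_of_add_ne_zero ℂ 𝔤 𝔥 hx hy (hPQ α hα γ hγ)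
  have h2 : rootSum P ≤ LinearMap.ker ((killingForm ℂ 𝔤).flip y) :=
    rootSum_le fun α hα x hx => h1 α hα x hx hy
  exact h2 hx

theorem IsPositiveSet.lie_mem {P : Set 𝔥.root} (hP : IsPositiveSet P) {x y : 𝔤}
    (hx : x ∈ rootSum P) (hy : y ∈ rootSum P) : ⁅x, y⁆ ∈ rootSum P := by
  have h1 : ∀ α ∈ P, ∀ x ∈ rootSubspace α,
      rootSum P ≤ (rootSum P).comap (LieAlgebra.ad ℂ 𝔤 x) := by
    refine fun α hα x hx => rootSum_le fun γ hγ y hy => ?_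
    rw [Submodule.mem_comap, ad_apply]
    have h := lie_mem_rootSpace hx hy
    rcases rootSpace_eq_bot_or ((α.1 : 𝔥 → ℂ) + (γ.1 : 𝔥 → ℂ)) with h0 | h0 | ⟨δ, hδ⟩
    · rw [← LieSubmodule.mem_toSubmodule, h0, Submodule.mem_bot] at h
      rw [h]; exact zero_mem _
    · exact absurd h0 (hP.add_ne_zero hα hγ)
    · rw [← hδ] at h
      exact rootSubspace_le_rootSum (hP.add_mem hα hγ hδ) h
  have h2 : rootSum P ≤ (rootSum P).comap (LieAlgebra.ad ℂ 𝔤 y) := rootSum_le fun α hα x hx => by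
    rw [Submodule.mem_comap, ad_apply, ← lie_skew]
    exact neg_mem (h1 α hα x hx hy)
  rw [← lie_skew]
  exact neg_mem (h2 hx)

/-! ### Subalgebras of the double built from root spaces -/

/-- The subspace `A_Δ + B_{-Δ} + (𝔤_P, 0) + (0, 𝔤_Q)` of `𝔤 ⊕ 𝔤`. -/
def doubleSum (A B : Submodule ℂ 𝔤) (P Q : Set 𝔥.root) : Submodule ℂ (𝔤 × 𝔤) :=
  diag A ⊔ antidiag B ⊔ (rootSum P).prod ⊥ ⊔ (⊥ : Submodule ℂ 𝔤).prod (rootSum Q)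

theorem mem_doubleSum {A B : Submodule ℂ 𝔤} {P Q : Set 𝔥.root} {p : 𝔤 × 𝔤} :
    p ∈ doubleSum A B P Q ↔ ∃ a ∈ A, ∃ b ∈ B, ∃ x ∈ rootSum P, ∃ y ∈ rootSum Q,
      p = (a + b + x, a - b + y) := by
  constructor
  · intro hp
    obtain ⟨p₁, hp₁, ⟨z, y⟩, ⟨hz, hy⟩, rfl⟩ := Submodule.mem_sup.mp hp
    obtain ⟨p₂, hp₂, ⟨x, z'⟩, ⟨hx, hz'⟩, rfl⟩ := Submodule.mem_sup.mp hp₁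
    obtain ⟨_, ⟨a, ha, rfl⟩, _, ⟨b, hb, rfl⟩, rfl⟩ := Submodule.mem_sup.mp hp₂
    obtain rfl : z = 0 := hz
    obtain rfl : z' = 0 := hz'
    exact ⟨a, ha, b, hb, x, hx, y, hy, by simp [sub_eq_add_neg]⟩
  · rintro ⟨a, ha, b, hb, x, hx, y, hy, rfl⟩
    have h : (a + b + x, a - b + y) = (a, a) + (b, -b) + (x, 0) + ((0, y) : 𝔤 × 𝔤) := by
      simp [sub_eq_add_neg]
    rw [h]
    exact Submodule.add_mem_sup (Submodule.add_mem_sup (Submodule.add_mem_sup ⟨a, ha, rfl⟩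
      ⟨b, hb, rfl⟩) ⟨hx, rfl⟩) ⟨rfl, hy⟩

/-- Root vectors pair only with opposite roots, which a positive set excludes. On the Cartan parts
the two halves of the form cancel except for the mixed terms between `A` and `B`, which vanish by
orthogonality. -/
theorem isotropic_doubleSum (c : ℂ) {A B : Submodule ℂ 𝔤} {P Q : Set 𝔥.root}
    (hA : A ≤ 𝔥.toSubmodule) (hB : B ≤ 𝔥.toSubmodule)
    (hAB : ∀ a ∈ A, ∀ b ∈ B, killingForm ℂ 𝔤 a b = 0)
    (hP : IsPositiveSet P) (hQ : IsPositiveSet Q) :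
    ∀ p ∈ doubleSum A B P Q, ∀ q ∈ doubleSum A B P Q, doubleForm c p q = 0 := by
  intro p hp q hq
  obtain ⟨a, ha, b, hb, x, hx, y, hy, rfl⟩ := mem_doubleSum.mp hp
  obtain ⟨a', ha', b', hb', x', hx', y', hy', rfl⟩ := mem_doubleSum.mp hq
  have hba : killingForm ℂ 𝔤 b a' = 0 := by
    rw [LieModule.traceForm_comm]; exact hAB a' ha' b hb
  simp only [doubleForm_apply, map_add, map_sub, LinearMap.add_apply, LinearMap.sub_apply,
    hAB a ha b' hb', hba, killingForm_cartan_rootSum (hA ha) hx',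
    killingForm_cartan_rootSum (hA ha) hy', killingForm_cartan_rootSum (hB hb) hx',
    killingForm_cartan_rootSum (hB hb) hy', killingForm_rootSum_cartan (hA ha') hx,
    killingForm_rootSum_cartan (hA ha') hy, killingForm_rootSum_cartan (hB hb') hx,
    killingForm_rootSum_cartan (hB hb') hy,
    killingForm_rootSum (fun α hα γ hγ => hP.add_ne_zero hα hγ) hx hx',
    killingForm_rootSum (fun α hα γ hγ => hQ.add_ne_zero hα hγ) hy hy']
  ring

/-- Since `𝔥` is abelian and a positive set contains no opposite roots, brackets have no Cartan
component; `A` and `B` need not be related. -/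
theorem isSubalgebra_doubleSum {A B : Submodule ℂ 𝔤} {P Q : Set 𝔥.root}
    (hA : A ≤ 𝔥.toSubmodule) (hB : B ≤ 𝔥.toSubmodule)
    (hP : IsPositiveSet P) (hQ : IsPositiveSet Q) : IsSubalgebra (doubleSum A B P Q) := by
  intro p hp q hq
  obtain ⟨a, ha, b, hb, x, hx, y, hy, rfl⟩ := mem_doubleSum.mp hp
  obtain ⟨a', ha', b', hb', x', hx', y', hy', rfl⟩ := mem_doubleSum.mp hq
  have key : ∀ {S : Set 𝔥.root}, IsPositiveSet S → ∀ {h h' z z' : 𝔤}, h ∈ 𝔥 → h' ∈ 𝔥 →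
      z ∈ rootSum S → z' ∈ rootSum S → ⁅h + z, h' + z'⁆ ∈ rootSum S := by
    intro S hS h h' z z' hh hh' hz hz'
    rw [lie_add, add_lie, add_lie, cartan_lie_cartan hh hh', zero_add, ← lie_skew]
    exact add_mem (neg_mem (cartan_lie_rootSum hh' hz))
      (add_mem (cartan_lie_rootSum hh hz') (hS.lie_mem hz hz'))
  exact mem_doubleSum.mpr ⟨0, zero_mem _, 0, zero_mem _, _,
    key hP (add_mem (hA ha) (hB hb)) (add_mem (hA ha') (hB hb')) hx hx', _,
    key hQ (sub_mem (hA ha) (hB hb)) (sub_mem (hA ha') (hB hb')) hy hy', by simp⟩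

/-! ### Isotropic subspaces of the double: dimension count. -/

theorem killingForm_nondegenerate : (killingForm ℂ 𝔤).Nondegenerate :=
  LieAlgebra.IsKilling.killingForm_nondegenerate ℂ 𝔤

theorem doubleForm_isRefl (c : ℂ) : (doubleForm c : LinearMap.BilinForm ℂ (𝔤 × 𝔤)).IsRefl := by
  intro p q h
  rw [doubleForm_apply] at h ⊢
  rw [LieModule.traceForm_comm ℂ 𝔤 𝔤 q.1, LieModule.traceForm_comm ℂ 𝔤 𝔤 q.2]
  exact h

theorem doubleForm_nondegenerate {c : ℂ} (hc : c ≠ 0) :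
    (doubleForm c : LinearMap.BilinForm ℂ (𝔤 × 𝔤)).Nondegenerate := by
  refine (LinearMap.IsRefl.nondegenerate_iff_separatingLeft
    (show LinearMap.IsRefl (doubleForm c) from doubleForm_isRefl c)).mpr ?_
  rintro ⟨x, y⟩ h
  have hx := killingForm_nondegenerate.1 x fun z => by
    simpa [doubleForm_apply, hc] using h (z, 0)
  have hy := killingForm_nondegenerate.1 y fun z => by
    simpa [doubleForm_apply, hc] using h (0, z)
  rw [hx, hy]; rfl

/-- An isotropic subspace of the double has dimension at most `dim 𝔤`. -/
theorem finrank_le_of_isotropic {c : ℂ} (hc : c ≠ 0) {l : Submodule ℂ (𝔤 × 𝔤)}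
    (hl : ∀ p ∈ l, ∀ q ∈ l, doubleForm c p q = 0) : finrank ℂ l ≤ finrank ℂ 𝔤 := by
  have h1 : l ≤ (doubleForm c).orthogonal l := fun q hq p hp => hl p hp q hq
  have h2 := Submodule.finrank_mono h1
  rw [LinearMap.BilinForm.finrank_orthogonal (doubleForm_nondegenerate hc), finrank_prod] at h2
  have h3 := Submodule.finrank_le l
  rw [finrank_prod] at h3
  omega

/-- Two subspaces of dimension at most `dim 𝔤` that span a space of dimension `2 dim 𝔤` both attain
the bound. This avoids counting roots. -/
theorem finrank_eq_of_isotropic_of_sup_eq_top {c : ℂ} (hc : c ≠ 0)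
    {l l' : Submodule ℂ (𝔤 × 𝔤)} (hl : ∀ p ∈ l, ∀ q ∈ l, doubleForm c p q = 0)
    (hl' : ∀ p ∈ l', ∀ q ∈ l', doubleForm c p q = 0) (h : l ⊔ l' = ⊤) :
    finrank ℂ l = finrank ℂ 𝔤 := by
  have h1 := finrank_le_of_isotropic hc hl
  have h2 := finrank_le_of_isotropic hc hl'
  have h3 := Submodule.finrank_add_le_finrank_add_finrank l l'
  rw [h, finrank_top, finrank_prod] at h3
  omega

theorem doubleSum_sup_compl {A B : Submodule ℂ 𝔤} {P Q : Set 𝔥.root}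
    (h : A ⊔ B = 𝔥.toSubmodule) : doubleSum A B P Q ⊔ doubleSum B A Pᶜ Qᶜ = ⊤ := by
  set L := doubleSum A B P Q ⊔ doubleSum B A Pᶜ Qᶜ
  have hA : ∀ a ∈ A, (a, a) ∈ L ∧ (a, -a) ∈ L := fun a ha =>
    ⟨Submodule.mem_sup_left (mem_doubleSum.mpr ⟨a, ha, 0, zero_mem _, 0, zero_mem _, 0, zero_mem _,
      by simp⟩), Submodule.mem_sup_right (mem_doubleSum.mpr ⟨0, zero_mem _, a, ha, 0, zero_mem _, 0,
      zero_mem _, by simp⟩)⟩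
  have hB : ∀ a ∈ B, (a, a) ∈ L ∧ (a, -a) ∈ L := fun a ha =>
    ⟨Submodule.mem_sup_right (mem_doubleSum.mpr ⟨a, ha, 0, zero_mem _, 0, zero_mem _, 0, zero_mem _,
      by simp⟩), Submodule.mem_sup_left (mem_doubleSum.mpr ⟨0, zero_mem _, a, ha, 0, zero_mem _, 0,
      zero_mem _, by simp⟩)⟩
  -- Half the sum and half the difference of `(a, a)` and `(a, -a)` separate the two factors.
  have half : ∀ a : 𝔤, (a, a) ∈ L ∧ (a, -a) ∈ L → (a, 0) ∈ L ∧ (0, a) ∈ L := by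
    rintro a ⟨h1, h2⟩
    have e1 : ((a, 0) : 𝔤 × 𝔤) = (2⁻¹ : ℂ) • ((a, a) + (a, -a)) := by
      ext <;> simp [← two_smul ℂ a, smul_smul]
    have e2 : ((0, a) : 𝔤 × 𝔤) = (2⁻¹ : ℂ) • ((a, a) - (a, -a)) := by
      ext <;> simp [← two_smul ℂ a, smul_smul]
    rw [e1, e2]
    exact ⟨Submodule.smul_mem _ _ (add_mem h1 h2), Submodule.smul_mem _ _ (sub_mem h1 h2)⟩
  have hl : ⊤ ≤ L.comap (LinearMap.inl ℂ 𝔤 𝔤) := by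
    rw [← cartan_sup_rootSum_univ (𝔥 := 𝔥), ← h, ← Set.union_compl_self P, rootSum_union]
    refine sup_le (sup_le (fun a ha => (half a (hA a ha)).1) fun a ha => (half a (hB a ha)).1)
      (sup_le (fun x hx => ?_) fun x hx => ?_)
    · exact Submodule.mem_sup_left (mem_doubleSum.mpr ⟨0, zero_mem _, 0, zero_mem _, x, hx, 0,
        zero_mem _, by simp⟩)
    · exact Submodule.mem_sup_right (mem_doubleSum.mpr ⟨0, zero_mem _, 0, zero_mem _, x, hx, 0,
        zero_mem _, by simp⟩)
  have hr : ⊤ ≤ L.comap (LinearMap.inr ℂ 𝔤 𝔤) := by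
    rw [← cartan_sup_rootSum_univ (𝔥 := 𝔥), ← h, ← Set.union_compl_self Q, rootSum_union]
    refine sup_le (sup_le (fun a ha => (half a (hA a ha)).2) fun a ha => (half a (hB a ha)).2)
      (sup_le (fun x hx => ?_) fun x hx => ?_)
    · exact Submodule.mem_sup_left (mem_doubleSum.mpr ⟨0, zero_mem _, 0, zero_mem _, 0,
        zero_mem _, x, hx, by simp⟩)
    · exact Submodule.mem_sup_right (mem_doubleSum.mpr ⟨0, zero_mem _, 0, zero_mem _, 0,
        zero_mem _, x, hx, by simp⟩)
  refine top_le_iff.mp ?_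
  rintro ⟨x, y⟩ -
  have : ((x, y) : 𝔤 × 𝔤) = (x, 0) + (0, y) := by simp
  rw [this]
  exact add_mem (hl (Submodule.mem_top (x := x))) (hr (Submodule.mem_top (x := y)))

theorem isLagrangian_doubleSum {c : ℂ} (hc : c ≠ 0) {A B : Submodule ℂ 𝔤} {P Q : Set 𝔥.root}
    (h : A ⊔ B = 𝔥.toSubmodule) (hAB : ∀ a ∈ A, ∀ b ∈ B, killingForm ℂ 𝔤 a b = 0)
    (hP : IsPositiveSet P) (hQ : IsPositiveSet Q) : IsLagrangian c (doubleSum A B P Q) := by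
  have hA : A ≤ 𝔥.toSubmodule := h ▸ le_sup_left
  have hB : B ≤ 𝔥.toSubmodule := h ▸ le_sup_right
  have hBA : ∀ b ∈ B, ∀ a ∈ A, killingForm ℂ 𝔤 b a = 0 := fun b hb a ha => by
    rw [LieModule.traceForm_comm]; exact hAB a ha b hb
  have hiso := isotropic_doubleSum c hA hB hAB hP hQ
  exact ⟨isSubalgebra_doubleSum hA hB hP hQ, finrank_eq_of_isotropic_of_sup_eq_top hc hiso
    (isotropic_doubleSum c hB hA hBA hP.compl hQ.compl) (doubleSum_sup_compl h), hiso⟩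

section

/-! ### Lagrangian subalgebras and coisotropic subalgebras -/

variable (b : (rootSystem 𝔥).Base)

/-! ### Weyl translates of the positive system, and inversion sets as their differences. -/

theorem isPos_negRoot (α : 𝔥.root) : b.IsPos (negRoot α) ↔ ¬ b.IsPos α := by
  let := (rootSystem 𝔥).indexNeg
  have h : negRoot α = -α := (rootSystem 𝔥).root.injective (by
    change _ = (rootSystem 𝔥).root ((rootSystem 𝔥).reflectionPerm α α)
    rw [RootPairing.root_reflectionPerm, RootPairing.reflection_apply_self]; rfl)
  rw [h]
  exact RootPairing.Base.IsPos.neg_iff_not b α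

/-- The set of roots `w Φ⁺`. -/
def posImage (w : (rootSystem 𝔥).weylGroup) : Set 𝔥.root :=
  {γ | b.IsPos ((rootSystem 𝔥).weylGroupToPerm w⁻¹ γ)}

theorem root_weylGroupToPerm (w : (rootSystem 𝔥).weylGroup) (α : 𝔥.root) :
    ((rootSystem 𝔥).weylGroupToPerm w α).1.toLinear = w • (α.1.toLinear : Dual ℂ 𝔥) :=
  ((rootSystem 𝔥).weylGroup_apply_root w α).symm

theorem weylGroupToPerm_negRoot (w : (rootSystem 𝔥).weylGroup) (α : 𝔥.root) :
    (rootSystem 𝔥).weylGroupToPerm w (negRoot α) = negRoot ((rootSystem 𝔥).weylGroupToPerm w α) := by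
  apply (rootSystem 𝔥).root.injective
  change ((rootSystem 𝔥).weylGroupToPerm w (negRoot α)).1.toLinear =
    -((rootSystem 𝔥).weylGroupToPerm w α).1.toLinear
  rw [root_weylGroupToPerm, root_weylGroupToPerm]
  exact smul_neg w (α.1.toLinear : Dual ℂ 𝔥)

theorem isPositiveSet_posImage (w : (rootSystem 𝔥).weylGroup) : IsPositiveSet (posImage b w) where
  neg_mem_iff α := by
    simp only [posImage, Set.mem_ofPred_eq, weylGroupToPerm_negRoot, isPos_negRoot]
  add_mem {α γ δ} hα hγ h := by
    refine RootPairing.Base.IsPos.add hα hγ ?_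
    have h' : (δ.1.toLinear : Dual ℂ 𝔥) = α.1.toLinear + γ.1.toLinear :=
      LinearMap.ext fun x => congrFun h x
    change ((rootSystem 𝔥).weylGroupToPerm w⁻¹ δ).1.toLinear =
      ((rootSystem 𝔥).weylGroupToPerm w⁻¹ α).1.toLinear +
        ((rootSystem 𝔥).weylGroupToPerm w⁻¹ γ).1.toLinear
    rw [root_weylGroupToPerm, root_weylGroupToPerm, root_weylGroupToPerm, h']
    exact smul_add w⁻¹ (α.1.toLinear : Dual ℂ 𝔥) γ.1.toLinear

theorem weylGroupToPerm_mem_posImage (w : (rootSystem 𝔥).weylGroup) (α : 𝔥.root) :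
    (rootSystem 𝔥).weylGroupToPerm w α ∈ posImage b w ↔ b.IsPos α := by
  simp only [posImage, Set.mem_ofPred_eq, ← Equiv.Perm.mul_apply, ← map_mul, inv_mul_cancel, map_one,
    Equiv.Perm.one_apply]

theorem exists_weylGroupToPerm_eq (w : (rootSystem 𝔥).weylGroup) (γ : 𝔥.root) :
    ∃ α, (rootSystem 𝔥).weylGroupToPerm w α = γ :=
  ((rootSystem 𝔥).weylGroupToPerm w).surjective γ

theorem nPos_eq (w : (rootSystem 𝔥).weylGroup) : nPos b w = rootSum (posImage b w) := by
  refine le_antisymm (iSup_le fun α => rootSubspace_le_rootSum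
    ((weylGroupToPerm_mem_posImage b w _).mpr α.2)) (rootSum_le fun γ hγ => ?_)
  obtain ⟨α, rfl⟩ := exists_weylGroupToPerm_eq w γ
  exact le_iSup (fun α : {α : 𝔥.root // b.IsPos α} =>
    rootSubspace ((rootSystem 𝔥).weylGroupToPerm w α.1))
    ⟨α, (weylGroupToPerm_mem_posImage b w α).mp hγ⟩

theorem nNeg_eq (w : (rootSystem 𝔥).weylGroup) : nNeg b w = rootSum (posImage b w)ᶜ := by
  refine le_antisymm (iSup_le fun α => rootSubspace_le_rootSum ?_) (rootSum_le fun γ hγ => ?_)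
  · rw [Set.mem_compl_iff, weylGroupToPerm_mem_posImage, isPos_negRoot, not_not]
    exact α.2
  · obtain ⟨α, rfl⟩ := exists_weylGroupToPerm_eq w γ
    rw [Set.mem_compl_iff, weylGroupToPerm_mem_posImage, ← isPos_negRoot] at hγ
    have h := le_iSup (fun α : {α : 𝔥.root // b.IsPos α} =>
      rootSubspace ((rootSystem 𝔥).weylGroupToPerm w (negRoot α.1))) ⟨negRoot α, hγ⟩
    rwa [negRoot_negRoot] at h

theorem lagr_eq (V : Submodule ℂ 𝔤) (u v : (rootSystem 𝔥).weylGroup) :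
    lagr b V u v = doubleSum V (cartanPerp 𝔥 V) (posImage b u) (posImage b v)ᶜ := by
  rw [lagr, doubleSum, nPos_eq, nNeg_eq]

theorem dualSubalgebra_eq :
    dualSubalgebra b = doubleSum ⊥ 𝔥.toSubmodule (posImage b 1) (posImage b 1)ᶜ := by
  rw [dualSubalgebra, doubleSum, nPos_eq, nNeg_eq, diag, Submodule.map_bot, bot_sup_eq]

theorem mem_posImage_one {α : 𝔥.root} : α ∈ posImage b 1 ↔ b.IsPos α := by
  simp [posImage]

theorem inversionSet_eq (w : (rootSystem 𝔥).weylGroup) :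
    inversionSet b w = posImage b 1 \ posImage b w := by
  ext α
  rw [Set.mem_sdiff, mem_posImage_one, inversionSet, Set.mem_ofPred_eq, isPos_negRoot]
  rfl

theorem iSup_inversionSet (w : (rootSystem 𝔥).weylGroup) :
    ⨆ α : inversionSet b w, rootSubspace α.1 = rootSum (posImage b 1 \ posImage b w) := by
  rw [← inversionSet_eq]; rfl

/-- Negation exchanges `Φ⁺ \ wΦ⁺` with `wΦ⁺ \ Φ⁺`. -/
theorem iSup_negRoot_inversionSet (w : (rootSystem 𝔥).weylGroup) :
    ⨆ α : inversionSet b w, rootSubspace (negRoot α.1) =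
      rootSum (posImage b w \ posImage b 1) := by
  have hneg : ∀ α, α ∈ posImage b w \ posImage b 1 ↔ negRoot α ∈ inversionSet b w := fun α => by
    rw [inversionSet_eq, Set.mem_sdiff, Set.mem_sdiff, (isPositiveSet_posImage b 1).neg_mem_iff,
      (isPositiveSet_posImage b w).neg_mem_iff, not_not, and_comm]
  refine le_antisymm (iSup_le fun α => rootSubspace_le_rootSum ?_) (rootSum_le fun α hα => ?_)
  · rw [hneg, negRoot_negRoot]; exact α.2
  · have h := le_iSup (fun α : inversionSet b w => rootSubspace (negRoot α.1))
      ⟨negRoot α, (hneg α).mp hα⟩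
    rwa [negRoot_negRoot] at h

theorem coisotropicFamily_eq (V : Submodule ℂ 𝔤) (u v : (rootSystem 𝔥).weylGroup) :
    coisotropicFamily b V u v = V ⊔ rootSum (posImage b u \ posImage b 1) ⊔
      rootSum (posImage b 1 \ posImage b v) := by
  rw [coisotropicFamily, iSup_inversionSet, iSup_negRoot_inversionSet]

theorem isSubalgebra_dualSubalgebra : IsSubalgebra (dualSubalgebra b) := by
  rw [dualSubalgebra_eq]
  exact isSubalgebra_doubleSum bot_le le_rfl (isPositiveSet_posImage b 1)
    (isPositiveSet_posImage b 1).compl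

theorem isotropic_dualSubalgebra (c : ℂ) :
    ∀ p ∈ dualSubalgebra b, ∀ q ∈ dualSubalgebra b, doubleForm c p q = 0 := by
  rw [dualSubalgebra_eq]
  refine isotropic_doubleSum c bot_le le_rfl (fun a ha x _ => ?_) (isPositiveSet_posImage b 1)
    (isPositiveSet_posImage b 1).compl
  rw [(Submodule.mem_bot ℂ).mp ha, map_zero, LinearMap.zero_apply]

/-- If `z = h + x = -h + y` with `x ∈ 𝔫` and `y ∈ 𝔫₋`, then `2h = y - x` is both in `𝔥` and in the
sum of the root spaces. So `h = 0`, and `x = y` lies in `𝔫 ∩ 𝔫₋ = 0`. -/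
theorem disjoint_diag_dualSubalgebra (m : Submodule ℂ 𝔤) :
    Disjoint (diag m) (dualSubalgebra b) := by
  rw [dualSubalgebra_eq, Submodule.disjoint_def]
  rintro _ ⟨z, -, rfl⟩ hp
  obtain ⟨a, ha, h, hh, x, hx, y, hy, he⟩ := mem_doubleSum.mp hp
  obtain rfl : a = 0 := ha
  have h1 : z = h + x := by simpa using congrArg Prod.fst he
  have h2 : z = -h + y := by simpa using congrArg Prod.snd he
  have h3 : (2 : ℂ) • h = y - x := by
    rw [two_smul, eq_sub_iff_add_eq, add_assoc, ← h1, h2, add_neg_cancel_left]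
  have h4 : (2 : ℂ) • h = 0 := Submodule.disjoint_def.mp (disjoint_cartan_rootSum Set.univ) _
    (Submodule.smul_mem _ _ hh)
    (h3 ▸ sub_mem (rootSum_mono (Set.subset_univ _) hy) (rootSum_mono (Set.subset_univ _) hx))
  have h5 : h = 0 := by simpa using h4
  have h6 : x = y := by rw [h4] at h3; exact (sub_eq_zero.mp h3.symm).symm
  have h7 : x = 0 := Submodule.disjoint_def.mp (disjoint_rootSum disjoint_compl_right) _ hx
    (h6 ▸ hy)
  have h8 : z = 0 := by rw [h1, h5, h7, add_zero]
  rw [h8, map_zero]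

theorem orthogonal_eq_of_isLagrangian {c : ℂ} (hc : c ≠ 0) {l : Submodule ℂ (𝔤 × 𝔤)}
    (hl : IsLagrangian c l) : (doubleForm c).orthogonal l = l := by
  have h : l ≤ (doubleForm c).orthogonal l := fun q hq p hp => hl.2.2 p hp q hq
  refine (Submodule.eq_of_le_of_finrank_le h ?_).symm
  rw [LinearMap.BilinForm.finrank_orthogonal (doubleForm_nondegenerate hc), finrank_prod, hl.2.1]
  omega

/-- A Lagrangian subalgebra that is spanned by a diagonal `m_Δ` and elements of `𝔤*` determines the
coisotropic subalgebra `m`. -/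
theorem isCoisotropicLagrangian_of_le {c : ℂ} (hc : c ≠ 0) {l : Submodule ℂ (𝔤 × 𝔤)}
    {m : Submodule ℂ 𝔤} (hl : IsLagrangian c l) (hm : diag m ≤ l)
    (hle : l ≤ diag m ⊔ (l ⊓ dualSubalgebra b)) : IsCoisotropicLagrangian b c l m := by
  have hann : annihilator b c m = l ⊓ dualSubalgebra b := by
    refine le_antisymm (fun p hp => ⟨?_, hp.1⟩) fun p hp => ⟨hp.2, ?_⟩
    · exact (Submodule.mem_dualAnnihilator _).mpr fun z hz => hl.2.2 p hp.1 _ (hm ⟨z, hz, rfl⟩)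
    -- As `l` is its own orthogonal, it suffices to pair `p` with `m_Δ`, where the annihilator
    -- condition applies, and with `l ∩ 𝔤*`, where isotropy of `𝔤*` applies.
    · rw [← orthogonal_eq_of_isLagrangian hc hl]
      intro q hq
      obtain ⟨_, ⟨z, hz, rfl⟩, q', hq', rfl⟩ := Submodule.mem_sup.mp (hle hq)
      have h1 : doubleForm c p (z, z) = 0 := (Submodule.mem_dualAnnihilator _).mp hp.2 z hz
      have h2 : doubleForm c q' p = 0 := isotropic_dualSubalgebra b c _ hq'.2 _ hp.1
      change doubleForm c ((z, z) + q') p = 0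
      rw [map_add, LinearMap.add_apply, h2, add_zero]
      exact doubleForm_isRefl c _ _ h1
  have hsub : IsSubalgebra (l ⊓ dualSubalgebra b) := fun p hp q hq =>
    ⟨hl.1 p hp.1 q hq.1, isSubalgebra_dualSubalgebra b p hp.2 q hq.2⟩
  have hdisj := disjoint_diag_dualSubalgebra b
  refine ⟨hl, ⟨fun x hx y hy => ?_, hann ▸ hsub⟩, ?_, ?_⟩
  -- The component of this diagonal bracket in `𝔤*` is again diagonal, hence zero, which leaves the
  -- bracket in `m_Δ`.
  · have h : ((⁅x, y⁆, ⁅x, y⁆) : 𝔤 × 𝔤) ∈ l := hl.1 _ (hm ⟨x, hx, rfl⟩) _ (hm ⟨y, hy, rfl⟩)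
    obtain ⟨_, ⟨z, hz, rfl⟩, q, hq, he⟩ := Submodule.mem_sup.mp (hle h)
    have hq' : q = (⁅x, y⁆ - z, ⁅x, y⁆ - z) := by
      rw [eq_sub_of_add_eq' he]; rfl
    have h0 := Submodule.disjoint_def.mp (hdisj ⊤) q
      (hq' ▸ ⟨⁅x, y⁆ - z, Submodule.mem_top, rfl⟩) hq.2
    rw [hq'] at h0
    rw [sub_eq_zero.mp (congrArg Prod.fst h0)]
    exact hz
  · rw [hann]
    exact le_antisymm hle (sup_le hm inf_le_left)
  · exact (hdisj m).mono_right inf_le_left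

/-- For `x ∈ 𝔤_α` with `α ∈ uΦ⁺`, either `α` is positive and `(x, 0)` already lies in `𝔤*`, or
disjointness of the inversion sets forces `α ∉ vΦ⁺`, and `(x, 0) = (x, x) - (0, x)` splits along
`𝔪_Δ` and `𝔩 ∩ 𝔤*`. The second factor is symmetric. -/
theorem isCoisotropicLagrangian_lagr {c : ℂ} (hc : c ≠ 0) {V : Submodule ℂ 𝔤}
    {u v : (rootSystem 𝔥).weylGroup} (hV : V ⊔ cartanPerp 𝔥 V = 𝔥.toSubmodule)
    (huv : inversionSet b u ∩ inversionSet b v = ∅) :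
    IsCoisotropicLagrangian b c (lagr b V u v) (coisotropicFamily b V u v) := by
  have hu := isPositiveSet_posImage b u
  have hv := isPositiveSet_posImage b v
  have h1 := isPositiveSet_posImage b (1 : (rootSystem 𝔥).weylGroup)
  rw [lagr_eq, coisotropicFamily_eq]
  rw [inversionSet_eq, inversionSet_eq] at huv
  -- Disjointness of `Φ_u` and `Φ_v` says that `uΦ⁺` and `vΦ⁺` together cover `Φ⁺`.
  have hsub : ∀ α ∈ posImage b 1, α ∈ posImage b u ∨ α ∈ posImage b v := fun α hα => by
    by_contra! h
    exact (huv ▸ ⟨⟨hα, h.1⟩, hα, h.2⟩ : α ∈ (∅ : Set 𝔥.root))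
  have huv' : ∀ α ∈ posImage b u, α ∉ posImage b 1 → α ∉ posImage b v := fun α hα hα1 => by
    rw [← h1.neg_mem_iff] at hα1
    rw [← hv.neg_mem_iff]
    exact (hsub _ hα1).resolve_left fun h => (hu.neg_mem_iff α).mp h hα
  have hvu : ∀ α, α ∉ posImage b v → α ∈ posImage b 1 → α ∈ posImage b u := fun α hα hα1 =>
    (hsub α hα1).resolve_right hα
  set l := doubleSum V (cartanPerp 𝔥 V) (posImage b u) (posImage b v)ᶜ
  set m := V ⊔ rootSum (posImage b u \ posImage b 1) ⊔ rootSum (posImage b 1 \ posImage b v)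
  have inl_mem : ∀ {A B : Submodule ℂ 𝔤} {P Q : Set 𝔥.root} {α : 𝔥.root} {x : 𝔤}, α ∈ P →
      x ∈ rootSubspace α → (x, 0) ∈ doubleSum A B P Q := fun {A B P Q α x} hα hx =>
    mem_doubleSum.mpr ⟨0, zero_mem _, 0, zero_mem _, x, rootSubspace_le_rootSum hα hx, 0,
      zero_mem _, by simp⟩
  have inr_mem : ∀ {A B : Submodule ℂ 𝔤} {P Q : Set 𝔥.root} {α : 𝔥.root} {x : 𝔤}, α ∈ Q →
      x ∈ rootSubspace α → (0, x) ∈ doubleSum A B P Q := fun {A B P Q α x} hα hx =>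
    mem_doubleSum.mpr ⟨0, zero_mem _, 0, zero_mem _, 0, zero_mem _, x,
      rootSubspace_le_rootSum hα hx, by simp⟩
  have split : ∀ x : 𝔤, ((x, x) : 𝔤 × 𝔤) = (x, 0) + (0, x) := fun x => by simp
  have hmV : V ≤ m := le_sup_left.trans le_sup_left
  have hmu : rootSum (posImage b u \ posImage b 1) ≤ m := le_sup_right.trans le_sup_left
  have hmv : rootSum (posImage b 1 \ posImage b v) ≤ m := le_sup_right
  refine isCoisotropicLagrangian_of_le b hc (isLagrangian_doubleSum hc hV
    (fun a ha x hx => hx.2 a ha) hu hv.compl) ?_ ?_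
  · refine Submodule.map_le_iff_le_comap.mpr (sup_le (sup_le (fun a ha => ?_)
      (rootSum_le fun α hα x hx => ?_)) (rootSum_le fun α hα x hx => ?_))
    · exact mem_doubleSum.mpr ⟨a, ha, 0, zero_mem _, 0, zero_mem _, 0, zero_mem _, by simp⟩
    · change ((x, x) : 𝔤 × 𝔤) ∈ l
      rw [split]
      exact add_mem (inl_mem hα.1 hx) (inr_mem (huv' α hα.1 hα.2) hx)
    · change ((x, x) : 𝔤 × 𝔤) ∈ l
      rw [split]
      exact add_mem (inl_mem (hvu α hα.2 hα.1) hx) (inr_mem hα.2 hx)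
  · rw [dualSubalgebra_eq]
    set D := doubleSum ⊥ 𝔥.toSubmodule (posImage b 1) (posImage b 1)ᶜ
    have hL : rootSum (posImage b u) ≤ (diag m ⊔ (l ⊓ D)).comap (LinearMap.inl ℂ 𝔤 𝔤) := by
      refine rootSum_le fun α hα x hx => ?_
      change ((x, 0) : 𝔤 × 𝔤) ∈ diag m ⊔ (l ⊓ D)
      by_cases h : α ∈ posImage b 1
      · exact Submodule.mem_sup_right ⟨inl_mem hα hx, inl_mem h hx⟩
      · rw [eq_sub_of_add_eq (split x).symm]
        exact sub_mem (Submodule.mem_sup_left ⟨x, hmu (rootSubspace_le_rootSum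
          (show α ∈ posImage b u \ posImage b 1 from ⟨hα, h⟩) hx), rfl⟩)
          (Submodule.mem_sup_right ⟨inr_mem (huv' α hα h) hx, inr_mem h hx⟩)
    have hR : rootSum (posImage b v)ᶜ ≤ (diag m ⊔ (l ⊓ D)).comap (LinearMap.inr ℂ 𝔤 𝔤) := by
      refine rootSum_le fun α hα x hx => ?_
      change ((0, x) : 𝔤 × 𝔤) ∈ diag m ⊔ (l ⊓ D)
      by_cases h : α ∈ posImage b 1
      · rw [eq_sub_of_add_eq' (split x).symm]
        exact sub_mem (Submodule.mem_sup_left ⟨x, hmv (rootSubspace_le_rootSum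
          (show α ∈ posImage b 1 \ posImage b v from ⟨h, hα⟩) hx), rfl⟩)
          (Submodule.mem_sup_right ⟨inl_mem (hvu α hα h) hx, inl_mem h hx⟩)
      · exact Submodule.mem_sup_right ⟨inr_mem hα hx, inr_mem h hx⟩
    intro p hp
    obtain ⟨a, ha, h, hh, x, hx, y, hy, rfl⟩ := mem_doubleSum.mp hp
    have he : (a + h + x, a - h + y) = (a, a) + (h, -h) + (x, 0) + ((0, y) : 𝔤 × 𝔤) := by
      simp [sub_eq_add_neg]
    rw [he]
    refine add_mem (add_mem (add_mem (Submodule.mem_sup_left ⟨a, hmV ha, rfl⟩)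
      (Submodule.mem_sup_right ⟨?_, ?_⟩)) (hL hx)) (hR hy)
    · exact mem_doubleSum.mpr ⟨0, zero_mem _, h, hh, 0, zero_mem _, 0, zero_mem _, by simp⟩
    · exact mem_doubleSum.mpr ⟨0, zero_mem _, h, hh.1, 0, zero_mem _, 0, zero_mem _, by simp⟩

end

/-! ### Orthogonal splitting of the Cartan subalgebra along a coroot. -/

theorem corootLine_sup_cartanPerp (β : 𝔥.root) :
    corootLine β ⊔ cartanPerp 𝔥 (corootLine β) = 𝔥.toSubmodule := by
  refine le_antisymm (sup_le ?_ inf_le_left) fun h hh => ?_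
  · rw [corootLine, Submodule.span_singleton_le_iff_mem]
    exact (coroot β.1).2
  have h2 : β.1 (coroot β.1) = 2 := root_apply_coroot (LieSubalgebra.isNonZero_coe_root β)
  -- Since `β(H_β) = 2`, this correction puts `k` in the kernel of `β`, which is the
  -- Killing-orthogonal of `H_β` in `𝔥`.
  set k : 𝔥 := ⟨h, hh⟩ - (β.1 ⟨h, hh⟩ / 2) • coroot β.1 with hk
  have hβk : β.1 k = 0 := by
    rw [← LieModule.Weight.toLinear_apply] at *
    rw [hk, map_sub, map_smul, LieModule.Weight.toLinear_apply, LieModule.Weight.toLinear_apply]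
    rw [LieModule.Weight.toLinear_apply] at h2
    rw [h2, smul_eq_mul, div_mul_cancel₀ _ two_ne_zero, sub_self]
  have hsplit : h = (β.1 ⟨h, hh⟩ / 2) • (coroot β.1 : 𝔤) + k := by
    rw [hk]; simp
  rw [hsplit]
  refine Submodule.add_mem_sup (Submodule.smul_mem _ _ (Submodule.mem_span_singleton_self _))
    ⟨k.2, fun a ha => ?_⟩
  obtain ⟨s, rfl⟩ := Submodule.mem_span_singleton.mp ha
  have h3 : killingForm ℂ 𝔤 (coroot β.1 : 𝔤) k = 0 := by
    have := traceForm_coroot β.1 k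
    rwa [hβk, smul_zero, smul_zero] at this
  rw [map_smul, LinearMap.smul_apply, h3, smul_zero]

/-! ### Long roots -/

theorem rootInner_eq (α γ : 𝔥.root) :
    rootInner α γ = α.1 ((cartanEquivDual 𝔥).symm γ.1.toLinear) := by
  have h := cartanEquivDual_apply_apply (H := 𝔥) ((cartanEquivDual 𝔥).symm α.1.toLinear)
    ((cartanEquivDual 𝔥).symm γ.1.toLinear)
  rw [LinearEquiv.apply_symm_apply] at h
  exact h.symm

theorem rootInner_comm (α γ : 𝔥.root) : rootInner α γ = rootInner γ α :=
  LieModule.traceForm_comm ℂ 𝔤 𝔤 _ _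

theorem rootInner_self_ne_zero (α : 𝔥.root) : rootInner α α ≠ 0 := by
  rw [rootInner_eq]
  exact root_apply_cartanEquivDual_symm_ne_zero (LieSubalgebra.isNonZero_coe_root α)

theorem apply_coroot_mul_rootInner (α β : 𝔥.root) :
    α.1 (coroot β.1) * rootInner β β = 2 * rootInner α β := by
  have h : α.1 (coroot β.1) = 2 * ((rootInner β β)⁻¹ * rootInner α β) := by
    rw [rootInner_eq, rootInner_eq, ← LieModule.Weight.toLinear_apply, coroot, map_nsmul, map_smul]
    simp
  rw [h]
  field_simp [rootInner_self_ne_zero β]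

theorem pairingIn_cast (α β : 𝔥.root) :
    (((rootSystem 𝔥).pairingIn ℤ α β : ℤ) : ℂ) = α.1 (coroot β.1) := by
  rw [← rootSystem_pairing_apply]
  exact (rootSystem 𝔥).algebraMap_pairingIn ℤ α β

/-- The trace formula for the Killing form gives `(β, β) = ∑ (γ, β)²`; substituting `2(γ, β) = ⟨γ,
β^∨⟩ (β, β)` and cancelling one factor `(β, β)` leaves an integer sum. Hence `(β, β)` is real and
positive. -/
theorem rootInner_self_mul_sum (β : 𝔥.root) :
    rootInner β β * ((∑ γ : 𝔥.root, (rootSystem 𝔥).pairingIn ℤ γ β ^ 2 : ℤ) : ℂ) = 4 := by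
  have h1 : rootInner β β = ∑ γ : 𝔥.root, rootInner γ β ^ 2 := by
    have h := congrArg (fun B : LinearMap.BilinForm ℂ 𝔥 =>
      B ((cartanEquivDual 𝔥).symm β.1.toLinear) ((cartanEquivDual 𝔥).symm β.1.toLinear))
      (restrict_killingForm_eq_sum (H := 𝔥))
    simp only [LinearMap.sum_apply, LinearMap.smulRight_apply, LinearMap.smul_apply,
      smul_eq_mul] at h
    rw [← Finset.sum_coe_sort 𝔥.root] at h
    refine h.trans (Finset.sum_congr rfl fun γ _ => ?_)
    rw [rootInner_eq, sq]; rfl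
  have h2 : ∀ γ : 𝔥.root, rootInner β β ^ 2 * (((rootSystem 𝔥).pairingIn ℤ γ β ^ 2 : ℤ) : ℂ) =
      4 * rootInner γ β ^ 2 := fun γ => by
    have := apply_coroot_mul_rootInner γ β
    push_cast
    rw [pairingIn_cast, ← mul_pow, mul_comm (rootInner β β), this]
    ring
  have h3 : rootInner β β * (rootInner β β *
      ((∑ γ : 𝔥.root, (rootSystem 𝔥).pairingIn ℤ γ β ^ 2 : ℤ) : ℂ)) = rootInner β β * 4 := by
    rw [← mul_assoc, ← sq, Int.cast_sum, Finset.mul_sum, Finset.sum_congr rfl fun γ _ => h2 γ,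
      ← Finset.mul_sum, ← h1, mul_comm]
  exact mul_left_cancel₀ (rootInner_self_ne_zero β) h3

theorem exists_rootInner_self_eq (β : 𝔥.root) : ∃ r : ℝ, 0 < r ∧ rootInner β β = r := by
  have h := rootInner_self_mul_sum β
  set N : ℤ := ∑ γ : 𝔥.root, (rootSystem 𝔥).pairingIn ℤ γ β ^ 2
  have hN0 : N ≠ 0 := fun h0 => by rw [h0, Int.cast_zero, mul_zero] at h; norm_num at h
  have hN : 0 < N := lt_of_le_of_ne (Finset.sum_nonneg fun γ _ => sq_nonneg _) hN0.symm
  refine ⟨4 / N, by positivity, ?_⟩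
  push_cast
  rw [eq_div_iff (by exact_mod_cast hN0), h]

/-- Non-orthogonal roots share a component, so `(α, α) ≤ (β, β)`. Then `⟨α, β^∨⟩ (β, β) = ⟨β, α^∨⟩
(α, α)` shows that `⟨α, β^∨⟩` is the smaller of the two Cartan integers in absolute value. -/
theorem IsLongRoot.apply_coroot_mem {β : 𝔥.root} (hβ : IsLongRoot β) {α : 𝔥.root} (h : α ≠ β)
    (h' : α ≠ negRoot β) :
    α.1 (coroot β.1) = 0 ∨ α.1 (coroot β.1) = 1 ∨ α.1 (coroot β.1) = -1 := by
  obtain ⟨r, hr, hβr⟩ := exists_rootInner_self_eq β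
  obtain ⟨s, hs, hαs⟩ := exists_rootInner_self_eq α
  have hmem := (rootSystem 𝔥).pairingIn_pairingIn_mem_set_of_isCrystal_of_isRed' α β
    (fun e => h ((rootSystem 𝔥).root.injective e))
    (fun e => h' ((rootSystem 𝔥).root.injective (e.trans rfl)))
  have hpq : ((rootSystem 𝔥).pairingIn ℤ α β : ℝ) * r = (rootSystem 𝔥).pairingIn ℤ β α * s := by
    have h1 := apply_coroot_mul_rootInner α β
    have h2 := apply_coroot_mul_rootInner β α
    rw [rootInner_comm β α, ← h1, ← pairingIn_cast, ← pairingIn_cast, hβr, hαs] at h2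
    exact_mod_cast h2.symm
  have hle : (rootSystem 𝔥).pairingIn ℤ α β ≠ 0 → s ≤ r := fun h0 => by
    have hne : rootInner β α ≠ 0 := fun h3 => by
      have h1 := apply_coroot_mul_rootInner α β
      rw [rootInner_comm α β, h3, mul_zero, ← pairingIn_cast] at h1
      rcases mul_eq_zero.mp h1 with h1 | h1
      · exact h0 (by exact_mod_cast h1)
      · exact rootInner_self_ne_zero β h1
    simpa [hβr, hαs] using hβ α (Relation.ReflTransGen.single hne)
  rw [← pairingIn_cast]
  generalize (rootSystem 𝔥).pairingIn ℤ α β = p at *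
  generalize (rootSystem 𝔥).pairingIn ℤ β α = q at *
  simp only [Set.mem_insert_iff, Set.mem_singleton_iff, Prod.mk.injEq] at hmem
  -- The finite list of Cartan integer pairs: those with `p = ±2` or `p = ±3` have `q = ±1` and
  -- would make `α` longer than `β`.
  rcases hmem with h | h | h | h | h | h | h | h | h | h | h <;> obtain ⟨rfl, rfl⟩ := h <;>
    first
    | (norm_num; done)
    | (exfalso; have := hle (by norm_num); push_cast at hpq; linarith)

theorem rootInner_negRoot_right (α γ : 𝔥.root) : rootInner α (negRoot γ) = -rootInner α γ := by
  have h : ((negRoot γ).1.toLinear : Dual ℂ 𝔥) = -γ.1.toLinear := rfl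
  rw [rootInner, rootInner, h, map_neg]
  simp

theorem IsLongRoot.negRoot {β : 𝔥.root} (hβ : IsLongRoot β) : IsLongRoot (negRoot β) := by
  intro α hα
  have h : rootInner (ZambonCoisotropic.negRoot β) (ZambonCoisotropic.negRoot β) =
      rootInner β β := by
    rw [rootInner_negRoot_right, rootInner_comm, rootInner_negRoot_right, neg_neg]
  rw [h]
  refine hβ α (hα.head ?_)
  rw [rootInner_negRoot_right]
  exact neg_ne_zero.mpr (rootInner_self_ne_zero β)

theorem coe_reflectionPerm (β α : 𝔥.root) : (((rootSystem 𝔥).reflectionPerm β α).1 : 𝔥 → ℂ) =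
    α.1 - α.1 (coroot β.1) • (β.1 : 𝔥 → ℂ) := by
  have h := (rootSystem 𝔥).root_reflectionPerm β α
  rw [RootPairing.reflection_apply_root] at h
  exact congrArg (fun f : Dual ℂ 𝔥 => (f : 𝔥 → ℂ)) h

theorem coe_apply_coroot_self (β : 𝔥.root) : β.1 (coroot β.1) = 2 :=
  root_apply_coroot (LieSubalgebra.isNonZero_coe_root β)

theorem apply_coroot_of_eq_add {α β μ : 𝔥.root} (h : (α.1 : 𝔥 → ℂ) = β.1 + μ.1) :
    α.1 (coroot β.1) = 2 + μ.1 (coroot β.1) := by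
  rw [h, Pi.add_apply, coe_apply_coroot_self]

/-- If `β` is long and `β + μ` is a root for a root `μ`, then `⟨μ, β^∨⟩ = -1`. -/
theorem IsLongRoot.apply_coroot_eq_neg_one {α β μ : 𝔥.root} (hβ : IsLongRoot β)
    (h : (α.1 : 𝔥 → ℂ) = β.1 + μ.1) (hμ : μ ≠ β) : μ.1 (coroot β.1) = -1 := by
  have hμ' : μ ≠ ZambonCoisotropic.negRoot β := fun e => root_coe_ne_zero α (by rw [h, e]; simp)
  have hα : α ≠ β := fun e => by simp [e] at h
  have hc := apply_coroot_of_eq_add h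
  -- Otherwise `μ` would pair with the coroot to `-4`.
  have hα' : α ≠ ZambonCoisotropic.negRoot β := fun e => by
    have h2 : α.1 (coroot β.1) = -2 := by
      rw [e, coe_negRoot, Pi.neg_apply, coe_apply_coroot_self]
    rw [h2] at hc
    rcases hβ.apply_coroot_mem hμ hμ' with h1 | h1 | h1 <;> rw [h1] at hc <;> norm_num at hc
  -- Both `t` and `2 + t` lie in `{0, 1, -1}` only for `t = -1`.
  rcases hβ.apply_coroot_mem hμ hμ' with h1 | h1 | h1 <;>
    rcases hβ.apply_coroot_mem hα hα' with h2 | h2 | h2 <;>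
    rw [h1, h2] at hc <;> first | exact h1 | (norm_num at hc)

/-- For a long root `β` in a positive set `P`, the elements of `P` that `s_β` maps out of `P`
are `β` and the roots `β + μ` with `μ ∉ P`. -/
theorem IsLongRoot.reflectionPerm_notMem_iff {β : 𝔥.root} (hβ : IsLongRoot β) {P : Set 𝔥.root}
    (hP : IsPositiveSet P) (hβP : β ∈ P) {α : 𝔥.root} (hα : α ∈ P) :
    (rootSystem 𝔥).reflectionPerm β α ∉ P ↔
      α = β ∨ ∃ μ, μ ∉ P ∧ (α.1 : 𝔥 → ℂ) = β.1 + μ.1 := by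
  have hs := coe_reflectionPerm β α
  constructor
  · intro h
    by_cases hαβ : α = β
    · exact .inl hαβ
    have hα' : α ≠ ZambonCoisotropic.negRoot β := fun e =>
      (hP.neg_mem_iff β).mp (e ▸ hα) hβP
    -- The pairings `0`, `1`, `-1` give `s_β α = α`, `α - β`, `α + β`; the first and last stay in
    -- `P`.
    rcases hβ.apply_coroot_mem hαβ hα' with h1 | h1 | h1
    · rw [h1, zero_smul, sub_zero] at hs
      exact absurd hα (root_ext hs ▸ h)
    · exact .inr ⟨_, h, by rw [hs, h1, one_smul, add_sub_cancel]⟩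
    · rw [h1, neg_smul, one_smul, sub_neg_eq_add] at hs
      exact absurd (hP.add_mem hα hβP hs) h
  · rintro (rfl | ⟨μ, hμ, h⟩)
    · rw [coe_apply_coroot_self] at hs
      have : (rootSystem 𝔥).reflectionPerm α α = ZambonCoisotropic.negRoot α :=
        root_ext (by rw [hs, coe_negRoot, two_smul]; abel)
      rw [this, hP.neg_mem_iff]
      exact not_not.mpr hα
    · have h1 := hβ.apply_coroot_eq_neg_one h fun e => hμ (e ▸ hβP)
      rw [apply_coroot_of_eq_add h, h1, h] at hs
      have : (rootSystem 𝔥).reflectionPerm β α = μ :=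
        root_ext (by rw [hs]; norm_num)
      rwa [this]

theorem mem_posImage_reflectionElt (b : (rootSystem 𝔥).Base) {α β : 𝔥.root} :
    α ∈ posImage b (reflectionElt β) ↔ (rootSystem 𝔥).reflectionPerm β α ∈ posImage b 1 := by
  have h : (rootSystem 𝔥).weylGroupToPerm (reflectionElt β) = (rootSystem 𝔥).reflectionPerm β := by
    simp [RootPairing.weylGroup.ofIdx]
  rw [mem_posImage_one, posImage, Set.mem_ofPred_eq, map_inv, h, RootPairing.reflectionPerm_inv]

theorem reflectionPerm_negRoot (β : 𝔥.root) :
    (rootSystem 𝔥).reflectionPerm (negRoot β) = (rootSystem 𝔥).reflectionPerm β := by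
  ext1 α
  refine root_ext ?_
  rw [coe_reflectionPerm, coe_reflectionPerm, coe_negRoot]
  have h : coroot (negRoot β).1 = -coroot β.1 := coroot_neg β.1
  rw [h, ← LieModule.Weight.toLinear_apply, map_neg, LieModule.Weight.toLinear_apply, smul_neg,
    neg_smul, neg_neg]

/-! ### The range of `[E_γ, π]^♯` -/

theorem sharp_add (R S : 𝔤 ⊗[ℂ] 𝔤) : sharp (R + S) = sharp R + sharp S := by
  simp [sharp]

theorem sharp_neg (R : 𝔤 ⊗[ℂ] 𝔤) : sharp (-R) = -sharp R := by
  simp [sharp]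

theorem sharp_smul (s : ℂ) (R : 𝔤 ⊗[ℂ] 𝔤) : sharp (s • R) = s • sharp R := by
  simp [sharp]

theorem sharp_sum {ι : Type*} (s : Finset ι) (R : ι → 𝔤 ⊗[ℂ] 𝔤) :
    sharp (∑ i ∈ s, R i) = ∑ i ∈ s, sharp (R i) := by
  simp [sharp]

theorem sharp_wedge (x y : 𝔤) (f : Dual ℂ 𝔤) : sharp (wedge x y) f = f x • y - f y • x := by
  rw [wedge, sub_eq_add_neg, sharp_add, sharp_neg, LinearMap.add_apply, LinearMap.neg_apply,
    sharp_tmul, sharp_tmul, sub_eq_add_neg]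

theorem sharp_lie (x : 𝔤) (R : 𝔤 ⊗[ℂ] 𝔤) (f : Dual ℂ 𝔤) :
    sharp ⁅x, R⁆ f = ⁅x, sharp R f⁆ + sharp R (f ∘ₗ LieAlgebra.ad ℂ 𝔤 x) := by
  induction R with
  | zero => simp [sharp]
  | tmul a b =>
    rw [TensorProduct.LieModule.lie_tmul_right, sharp_add, LinearMap.add_apply, sharp_tmul,
      sharp_tmul, sharp_tmul, sharp_tmul, lie_smul, LinearMap.comp_apply, ad_apply, add_comm]
  | add a b ha hb =>
    rw [lie_add, sharp_add, sharp_add, LinearMap.add_apply, ha, hb, LinearMap.add_apply, lie_add,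
      LinearMap.add_apply]
    abel

theorem killingForm_comp_ad (x y : 𝔤) :
    killingForm ℂ 𝔤 y ∘ₗ LieAlgebra.ad ℂ 𝔤 x = -killingForm ℂ 𝔤 ⁅x, y⁆ := by
  ext z
  rw [LinearMap.comp_apply, ad_apply, ← LieModule.traceForm_apply_lie_apply, ← lie_skew, map_neg]

/-- In terms of the Killing form, `[x, R]^♯` is the commutator of `ad x` and `R^♯`. -/
theorem sharp_lie_killingForm (x y : 𝔤) (R : 𝔤 ⊗[ℂ] 𝔤) :
    sharp ⁅x, R⁆ (killingForm ℂ 𝔤 y) =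
      ⁅x, sharp R (killingForm ℂ 𝔤 y)⁆ - sharp R (killingForm ℂ 𝔤 ⁅x, y⁆) := by
  rw [sharp_lie, killingForm_comp_ad, map_neg, sub_eq_add_neg]

theorem range_sharp (R : 𝔤 ⊗[ℂ] 𝔤) :
    LinearMap.range (sharp R) = LinearMap.range (sharp R ∘ₗ killingForm ℂ 𝔤) := by
  have h : LinearMap.range (killingForm ℂ 𝔤) = ⊤ :=
    LinearMap.range_eq_top.mpr
      (LinearMap.BilinForm.toDual _ (killingForm_nondegenerate (𝔤 := 𝔤))).surjective
  rw [LinearMap.range_comp, h, Submodule.map_top]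

/-! ### Root vectors: spanning, pairing and nonvanishing brackets. -/

theorem rootSubspace_eq_span {α : 𝔥.root} {x : 𝔤} (hx : x ∈ rootSubspace α) (h0 : x ≠ 0) :
    rootSubspace α = ℂ ∙ x := by
  have h1 : finrank ℂ (rootSubspace α) = 1 :=
    finrank_rootSpace_eq_one α.1 (LieSubalgebra.isNonZero_coe_root α)
  refine (Submodule.eq_of_le_of_finrank_le ?_ ?_).symm
  · rwa [Submodule.span_singleton_le_iff_mem]
  · rw [h1, finrank_span_singleton h0]

theorem killingForm_rootSubspace_neg_ne_zero {α : 𝔥.root} {x y : 𝔤} (hx : x ∈ rootSubspace α)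
    (hx0 : x ≠ 0) (hy : y ∈ rootSubspace (negRoot α)) (hy0 : y ≠ 0) :
    killingForm ℂ 𝔤 x y ≠ 0 := fun h => hx0 <| by
  have h1 := mem_ker_killingForm_of_mem_rootSpace_of_forall_rootSpace_neg ℂ 𝔤 𝔥 hx fun z hz => by
    have hz' : z ∈ rootSubspace (negRoot α) := hz
    rw [rootSubspace_eq_span hy hy0] at hz'
    obtain ⟨s, rfl⟩ := Submodule.mem_span_singleton.mp hz'
    rw [map_smul, h, smul_zero]
  simpa using h1

/-- If the bracket vanished, `y` would be a primitive vector of weight `-1` for the `sl₂` of `β`,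
but primitive vectors in finite dimension have weights in `ℕ`. -/
theorem lie_ne_zero_of_apply_coroot_eq_neg_one {β μ : 𝔥.root} (h : μ.1 (coroot β.1) = -1)
    {x y : 𝔤} (hx : x ∈ rootSubspace β) (hx0 : x ≠ 0) (hy : y ∈ rootSubspace μ) (hy0 : y ≠ 0) :
    ⁅x, y⁆ ≠ 0 := fun hxy => by
  have hβ := LieSubalgebra.isNonZero_coe_root β
  obtain ⟨k, e, f, ht, he, hf⟩ := exists_isSl2Triple_of_weight_isNonZero hβ
  have he' : e ∈ rootSubspace β := he
  rw [rootSubspace_eq_span hx hx0] at he'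
  obtain ⟨s, rfl⟩ := Submodule.mem_span_singleton.mp he'
  have P : ht.HasPrimitiveVectorWith y (-1 : ℂ) :=
    { ne_zero := hy0
      lie_h := by
        rw [ht.h_eq_coroot hβ he hf, cartan_lie_rootSubspace (coroot β.1).2 hy, ← h]
      lie_e := by rw [smul_lie, hxy, smul_zero] }
  obtain ⟨n, hn⟩ := P.exists_nat
  have : ((n + 1 : ℕ) : ℂ) = 0 := by push_cast; rw [← hn]; norm_num
  exact Nat.succ_ne_zero n (by exact_mod_cast this)

open Classical in
/-- The bivector `∑_{α ∈ P} λ_α E_α ∧ E_{-α}` with `λ_α = 1 / K(E_α, E_{-α})`. -/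
def bivectorOn (P : Set 𝔥.root) (E : 𝔥.root → 𝔤) : 𝔤 ⊗[ℂ] 𝔤 :=
  ∑ α : 𝔥.root with α ∈ P,
    (1 / killingForm ℂ 𝔤 (E α) (E (negRoot α))) • wedge (E α) (E (negRoot α))

theorem bivector_eq (b : (rootSystem 𝔥).Base) (E : 𝔥.root → 𝔤) :
    bivector b E = bivectorOn (posImage b 1) E := by
  classical
  rw [bivector, bivectorOn]
  refine Finset.sum_congr (Finset.filter_congr fun α _ => (mem_posImage_one b).symm) fun _ _ => rfl

/-- Replacing `α` by `-α` keeps the coefficient, by symmetry of the Killing form, and reverses the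
wedge. -/
theorem bivectorOn_compl {P : Set 𝔥.root} (hP : IsPositiveSet P) (E : 𝔥.root → 𝔤) :
    bivectorOn Pᶜ E = -bivectorOn P E := by
  classical
  rw [bivectorOn, bivectorOn, ← Finset.sum_neg_distrib]
  refine Finset.sum_bij' (fun α _ => negRoot α) (fun α _ => negRoot α) ?_ ?_ ?_ ?_ ?_
  · intro α hα
    simpa [hP.neg_mem_iff] using hα
  · intro α hα
    simpa [hP.neg_mem_iff] using hα
  · exact fun α _ => negRoot_negRoot α
  · exact fun α _ => negRoot_negRoot α
  · intro α _
    rw [negRoot_negRoot, LieModule.traceForm_comm, ← smul_neg, wedge, wedge, neg_sub]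

section

variable {P : Set 𝔥.root} (hP : IsPositiveSet P) {E : 𝔥.root → 𝔤}
  (hE : ∀ α, E α ∈ rootSubspace α) (hE0 : ∀ α, E α ≠ 0)

include hE in
theorem sharp_bivectorOn_cartan {h : 𝔤} (hh : h ∈ 𝔥) :
    sharp (bivectorOn P E) (killingForm ℂ 𝔤 h) = 0 := by
  classical
  have hK : ∀ α, killingForm ℂ 𝔤 h (E α) = 0 := fun α =>
    killingForm_cartan_rootSum hh (rootSubspace_le_rootSum (Set.mem_univ α) (hE α))
  rw [bivectorOn, sharp_sum, LinearMap.sum_apply]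
  refine Finset.sum_eq_zero fun α _ => ?_
  rw [sharp_smul, LinearMap.smul_apply, sharp_wedge, hK, hK, zero_smul, zero_smul, sub_zero,
    smul_zero]

-- Only the summand `α = μ` pairs with `𝔤_μ`, through `E_{-μ}`, and its coefficient normalises the
-- result to `-y`, whatever the scaling of the root vectors.
include hP hE hE0 in
theorem sharp_bivectorOn_of_mem {μ : 𝔥.root} (hμ : μ ∈ P) {y : 𝔤} (hy : y ∈ rootSubspace μ) :
    sharp (bivectorOn P E) (killingForm ℂ 𝔤 y) = -y := by
  classical
  have hK : ∀ α : 𝔥.root, α ≠ negRoot μ → killingForm ℂ 𝔤 y (E α) = 0 := fun α hα =>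
    killingForm_apply_eq_zero_of_mem_rootSpace_of_add_ne_zero ℂ 𝔤 𝔥 hy (hE α)
      fun h => hα (root_ext (by rw [coe_negRoot]; exact eq_neg_of_add_eq_zero_right h))
  rw [bivectorOn, sharp_sum, LinearMap.sum_apply, Finset.sum_eq_single μ]
  · have hne := killingForm_rootSubspace_neg_ne_zero (hE μ) (hE0 μ) (hE (negRoot μ)) (hE0 _)
    have h1 : killingForm ℂ 𝔤 y (E μ) = 0 := hK μ fun e => (hP.neg_mem_iff μ).mp (e ▸ hμ) hμ
    rw [rootSubspace_eq_span (hE μ) (hE0 μ)] at hy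
    obtain ⟨s, rfl⟩ := Submodule.mem_span_singleton.mp hy
    rw [sharp_smul, LinearMap.smul_apply, sharp_wedge, h1, zero_smul, zero_sub, map_smul,
      LinearMap.smul_apply, smul_neg, smul_smul, smul_eq_mul, mul_comm s, ← mul_assoc,
      one_div_mul_cancel hne, one_mul]
  · intro α hα hαμ
    have hαP : α ∈ P := (Finset.mem_filter.mp hα).2
    have h1 : killingForm ℂ 𝔤 y (E α) = 0 := hK α fun e => (hP.neg_mem_iff μ).mp (e ▸ hαP) hμ
    have h2 : killingForm ℂ 𝔤 y (E (negRoot α)) = 0 := hK _ fun e => hαμ (by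
      rw [← negRoot_negRoot α, e, negRoot_negRoot])
    rw [sharp_smul, LinearMap.smul_apply, sharp_wedge, h1, h2, zero_smul, zero_smul, sub_zero,
      smul_zero]
  · exact fun h => absurd (Finset.mem_filter.mpr ⟨Finset.mem_univ μ, hμ⟩) h

include hP hE hE0 in
theorem sharp_bivectorOn_of_notMem {μ : 𝔥.root} (hμ : μ ∉ P) {y : 𝔤} (hy : y ∈ rootSubspace μ) :
    sharp (bivectorOn P E) (killingForm ℂ 𝔤 y) = y := by
  have h := sharp_bivectorOn_of_mem hP.compl hE hE0 (Set.mem_compl hμ) hy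
  rw [bivectorOn_compl hP, sharp_neg, LinearMap.neg_apply] at h
  exact neg_injective h

include hP hE hE0 in
/-- For a long root `β` in a positive set `P`, the range of `[E_β, π_P]^♯` is
`ℂ H_β + ∑ 𝔤_α`, the sum over the `α ∈ P` with `s_β α ∉ P`. -/
theorem range_sharp_lie_bivectorOn {β : 𝔥.root} (hβ : IsLongRoot β) (hβP : β ∈ P) :
    LinearMap.range (sharp ⁅E β, bivectorOn P E⁆) =
      corootLine β ⊔ rootSum {α | α ∈ P ∧ (rootSystem 𝔥).reflectionPerm β α ∉ P} := by
  have hT : {α | α ∈ P ∧ (rootSystem 𝔥).reflectionPerm β α ∉ P} =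
      {α | α ∈ P ∧ (α = β ∨ ∃ μ, μ ∉ P ∧ (α.1 : 𝔥 → ℂ) = β.1 + μ.1)} := by
    ext α
    exact and_congr_right fun hα => hβ.reflectionPerm_notMem_iff hP hβP hα
  rw [hT, range_sharp]
  have hcar := fun {h : 𝔤} (hh : h ∈ 𝔥) => sharp_bivectorOn_cartan (P := P) hE hh
  have hpos := fun {μ : 𝔥.root} (hμ : μ ∈ P) {y : 𝔤} (hy : y ∈ rootSubspace μ) =>
    sharp_bivectorOn_of_mem hP hE hE0 hμ hy
  have hneg := fun {μ : 𝔥.root} (hμ : μ ∉ P) {y : 𝔤} (hy : y ∈ rootSubspace μ) =>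
    sharp_bivectorOn_of_notMem hP hE hE0 hμ hy
  set U := corootLine β ⊔ rootSum {α | α ∈ P ∧ (α = β ∨ ∃ μ, μ ∉ P ∧ (α.1 : 𝔥 → ℂ) = β.1 + μ.1)}
  set F := sharp ⁅E β, bivectorOn P E⁆ ∘ₗ killingForm ℂ 𝔤
  have hFy : ∀ y, F y = ⁅E β, sharp (bivectorOn P E) (killingForm ℂ 𝔤 y)⁆ -
      sharp (bivectorOn P E) (killingForm ℂ 𝔤 ⁅E β, y⁆) := fun y =>
    sharp_lie_killingForm (E β) y _
  have hUβ : rootSubspace β ≤ U := (rootSubspace_le_rootSum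
    (show β ∈ {α | α ∈ P ∧ (α = β ∨ ∃ μ, μ ∉ P ∧ (α.1 : 𝔥 → ℂ) = β.1 + μ.1)} from
      ⟨hβP, .inl rfl⟩)).trans le_sup_right
  have hEβ0 : ∀ y ∈ rootSubspace (negRoot β),
      ⁅E β, y⁆ = killingForm ℂ 𝔤 (E β) y • ((cartanEquivDual 𝔥).symm β.1.toLinear : 𝔤) :=
    fun y hy => lie_eq_killingForm_smul_of_mem_rootSpace_of_mem_rootSpace_neg (hE β) hy
  -- `H_β = 2 t_β / (β, β)`, so the coroot and the Killing dual of `β` span the same line.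
  have hcoroot : corootLine β = ℂ ∙ ((cartanEquivDual 𝔥).symm β.1.toLinear : 𝔤) := by
    have h0 := root_apply_cartanEquivDual_symm_ne_zero (LieSubalgebra.isNonZero_coe_root β)
    have hu : IsUnit (2 * (β.1 ((cartanEquivDual 𝔥).symm β.1.toLinear))⁻¹) :=
      (mul_ne_zero two_ne_zero (inv_ne_zero h0)).isUnit
    rw [corootLine, coroot, ← Submodule.span_singleton_smul_eq hu
      ((cartanEquivDual 𝔥).symm β.1.toLinear : 𝔤)]
    congr 2
    simp [two_smul, two_mul, add_smul]
  have hEβh : ∀ {h : 𝔤} (hh : h ∈ 𝔥), ⁅E β, h⁆ = -(β.1 ⟨h, hh⟩ • E β) := fun {h} hh => by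
    rw [← lie_skew, cartan_lie_rootSubspace hh (hE β)]
  have hneg' : negRoot β ∉ P := fun h => (hP.neg_mem_iff β).mp h hβP
  -- For `≤`, evaluate `F = (r_μ - r_{β+μ}) ad E_β` weight by weight. For `≥`, the vectors `E_{-β}`,
  -- `H_β` and `E_μ` are sent to `K(E_β, E_{-β}) t_β`, `-2 E_β` and `2 [E_β, E_μ]`, all nonzero.
  refine le_antisymm ?_ ?_
  · rw [LinearMap.range_eq_map, Submodule.map_le_iff_le_comap,
      ← cartan_sup_rootSum_univ (𝔥 := 𝔥)]
    refine sup_le (fun h hh => ?_) (rootSum_le fun μ _ y hy => ?_)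
    · have hmem : ⁅E β, h⁆ ∈ rootSubspace β := by
        rw [hEβh hh]; exact neg_mem (Submodule.smul_mem _ _ (hE β))
      rw [Submodule.mem_comap, hFy, hcar hh, lie_zero, zero_sub, hpos hβP hmem, neg_neg]
      exact hUβ hmem
    · rw [Submodule.mem_comap, hFy]
      have hlie := lie_mem_rootSpace (hE β) hy
      rcases rootSpace_eq_bot_or ((β.1 : 𝔥 → ℂ) + (μ.1 : 𝔥 → ℂ)) with h0 | h0 | ⟨δ, hδ⟩
      · rw [← LieSubmodule.mem_toSubmodule, h0, Submodule.mem_bot] at hlie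
        by_cases hμ : μ ∈ P
        · rw [hpos hμ hy, lie_neg, hlie]; simp
        · rw [hneg hμ hy, hlie]; simp
      · obtain rfl : μ = negRoot β :=
          root_ext (by rw [coe_negRoot]; exact eq_neg_of_add_eq_zero_right h0)
        have h1 : ⁅E β, y⁆ ∈ corootLine β := by
          rw [hEβ0 y hy, hcoroot]
          exact Submodule.smul_mem _ _ (Submodule.mem_span_singleton_self _)
        have h2 : ⁅E β, y⁆ ∈ 𝔥 := by
          rw [hEβ0 y hy]; exact 𝔥.smul_mem _ (Subtype.property _)
        rw [hneg hneg' hy, hcar h2, sub_zero]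
        exact Submodule.mem_sup_left h1
      · rw [← hδ] at hlie
        by_cases hμ : μ ∈ P
        · rw [hpos hμ hy, hpos (hP.add_mem hβP hμ hδ) hlie, lie_neg, sub_self]
          exact zero_mem _
        · rw [hneg hμ hy]
          by_cases hδP : δ ∈ P
          · have hδU : rootSubspace δ ≤ U := (rootSubspace_le_rootSum
              (show δ ∈ {α | α ∈ P ∧ (α = β ∨ ∃ μ, μ ∉ P ∧ (α.1 : 𝔥 → ℂ) = β.1 + μ.1)} from
                ⟨hδP, .inr ⟨μ, hμ, hδ⟩⟩)).trans le_sup_right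
            rw [hpos hδP hlie]
            exact sub_mem (hδU hlie) (neg_mem (hδU hlie))
          · rw [hneg hδP hlie, sub_self]
            exact zero_mem _
  · refine sup_le ?_ (rootSum_le ?_)
    · have hk := killingForm_rootSubspace_neg_ne_zero (hE β) (hE0 β) (hE (negRoot β)) (hE0 _)
      have h2 : ⁅E β, E (negRoot β)⁆ ∈ 𝔥 := by
        rw [hEβ0 _ (hE _)]; exact 𝔥.smul_mem _ (Subtype.property _)
      have h1 : F (E (negRoot β)) ∈ LinearMap.range F := ⟨_, rfl⟩
      rw [hFy, hneg hneg' (hE _), hcar h2, sub_zero, hEβ0 _ (hE _)] at h1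
      rw [hcoroot, Submodule.span_singleton_le_iff_mem]
      exact (Submodule.smul_mem_iff _ hk).mp h1
    · rintro α ⟨hα, rfl | ⟨μ, hμ, hαμ⟩⟩
      · have h1 : F (coroot α.1 : 𝔤) ∈ LinearMap.range F := ⟨_, rfl⟩
        have h2 : ⁅E α, (coroot α.1 : 𝔤)⁆ = (-2 : ℂ) • E α := by
          rw [hEβh (coroot α.1).2, neg_smul]
          exact congrArg (fun s : ℂ => -(s • E α)) (coe_apply_coroot_self α)
        rw [hFy, hcar (coroot α.1).2, lie_zero, zero_sub, h2,
          hpos hα (Submodule.smul_mem _ _ (hE α)), neg_neg] at h1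
        rw [rootSubspace_eq_span (hE α) (hE0 α), Submodule.span_singleton_le_iff_mem]
        exact (Submodule.smul_mem_iff _ (by norm_num)).mp h1
      · have hc := hβ.apply_coroot_eq_neg_one hαμ fun e => hμ (e ▸ hβP)
        have h0 := lie_ne_zero_of_apply_coroot_eq_neg_one hc (hE β) (hE0 β) (hE μ) (hE0 μ)
        have hlie : ⁅E β, E μ⁆ ∈ rootSubspace α := by
          have := lie_mem_rootSpace (hE β) (hE μ)
          rwa [← hαμ] at this
        have h1 : F (E μ) ∈ LinearMap.range F := ⟨_, rfl⟩
        rw [hFy, hneg hμ (hE μ), hpos hα hlie, sub_neg_eq_add, ← two_smul ℂ] at h1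
        rw [rootSubspace_eq_span hlie h0, Submodule.span_singleton_le_iff_mem]
        exact (Submodule.smul_mem_iff _ two_ne_zero).mp h1

end

/-! ### The two subspaces `𝔲_β` and `𝔲_{-β}` for a positive long root. -/

theorem corootLine_negRoot (β : 𝔥.root) : corootLine (negRoot β) = corootLine β := by
  have h : coroot (negRoot β).1 = -coroot β.1 := coroot_neg β.1
  rw [corootLine, corootLine, h, NegMemClass.coe_neg, ← Set.neg_singleton, Submodule.span_neg]

section

variable (b : (rootSystem 𝔥).Base) {E : 𝔥.root → 𝔤} (hE : ∀ α, E α ∈ rootSubspace α)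
  (hE0 : ∀ α, E α ≠ 0) {β : 𝔥.root} (hpos : b.IsPos β) (hlong : IsLongRoot β)

include hE hE0 hpos hlong in
theorem zambon_eq : zambon b E β =
    corootLine β ⊔ rootSum (posImage b 1 \ posImage b (reflectionElt β)) := by
  rw [zambon, bivector_eq, range_sharp_lie_bivectorOn (isPositiveSet_posImage b 1) hE hE0 hlong
    ((mem_posImage_one b).mpr hpos)]
  congr 2

-- The root `-β` is long and lies in the positive set `Φ⁻`, whose bivector is `-π`; the sign does
-- not change the range, and `s_{-β} = s_β`.
include hE hE0 hpos hlong in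
theorem zambon_negRoot_eq : zambon b E (negRoot β) =
    corootLine β ⊔ rootSum (posImage b (reflectionElt β) \ posImage b 1) := by
  have h1 := isPositiveSet_posImage b (1 : (rootSystem 𝔥).weylGroup)
  have hmem : negRoot β ∈ (posImage b 1)ᶜ := by
    rw [Set.mem_compl_iff, h1.neg_mem_iff, not_not, mem_posImage_one]
    exact hpos
  have h := range_sharp_lie_bivectorOn h1.compl hE hE0 hlong.negRoot hmem
  rw [bivectorOn_compl h1, lie_neg, sharp_neg, LinearMap.range_neg, ← bivector_eq,
    corootLine_negRoot, reflectionPerm_negRoot] at h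
  rw [zambon, h]
  congr 2
  ext α
  rw [Set.mem_sdiff, mem_posImage_reflectionElt, and_comm, Set.mem_ofPred_eq, Set.mem_compl_iff,
    Set.mem_compl_iff, not_not]

end

theorem isInternalDirectSum_corootLine (β : 𝔥.root) {ι : Type*} {g : ι → 𝔥.root}
    (hg : Function.Injective g) :
    IsInternalDirectSum (corootLine β ⊔ ⨆ i, rootSubspace (g i))
      (corootLine β) fun i => rootSubspace (g i) := by
  refine ⟨rfl, (disjoint_cartan_rootSum (𝔥 := 𝔥) Set.univ).mono ?_ ?_, iSupIndep_rootSubspace.comp hg⟩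
  · rw [corootLine, Submodule.span_singleton_le_iff_mem]
    exact (coroot β.1).2
  · exact iSup_le fun i => rootSubspace_le_rootSum (Set.mem_univ _)

end ZambonCoisotropic

end

open ZambonCoisotropic in
theorem mainTheorem3 {𝔤 : Type*} [LieRing 𝔤] [LieAlgebra ℂ 𝔤] [FiniteDimensional ℂ 𝔤]
    [LieAlgebra.IsSemisimple ℂ 𝔤] (𝔥 : LieSubalgebra ℂ 𝔤) [𝔥.IsCartanSubalgebra]
    (b : (LieAlgebra.IsKilling.rootSystem 𝔥).Base) (c : ℂ) (hc : c ≠ 0)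
    (E : 𝔥.root → 𝔤) (hE : ∀ α, E α ∈ ZambonCoisotropic.rootSubspace α) (hE0 : ∀ α, E α ≠ 0)
    (β : 𝔥.root) (hpos : b.IsPos β) (hlong : ZambonCoisotropic.IsLongRoot β) :
    ZambonCoisotropic.IsInternalDirectSum (ZambonCoisotropic.zambon b E β)
      (ZambonCoisotropic.corootLine β)
      (fun α : ZambonCoisotropic.inversionSet b (ZambonCoisotropic.reflectionElt β) =>
        ZambonCoisotropic.rootSubspace α.1) ∧
    ZambonCoisotropic.IsInternalDirectSum
      (ZambonCoisotropic.zambon b E (ZambonCoisotropic.negRoot β))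
      (ZambonCoisotropic.corootLine β)
      (fun α : ZambonCoisotropic.inversionSet b (ZambonCoisotropic.reflectionElt β) =>
        ZambonCoisotropic.rootSubspace (ZambonCoisotropic.negRoot α.1)) ∧
    ZambonCoisotropic.inversionSet b 1 ∩
      ZambonCoisotropic.inversionSet b (ZambonCoisotropic.reflectionElt β) = ∅ ∧
    ZambonCoisotropic.zambon b E β = ZambonCoisotropic.coisotropicFamily b
      (ZambonCoisotropic.corootLine β) 1 (ZambonCoisotropic.reflectionElt β) ∧
    ZambonCoisotropic.IsCoisotropicLagrangian b c
      (ZambonCoisotropic.lagr b (ZambonCoisotropic.corootLine β) 1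
        (ZambonCoisotropic.reflectionElt β))
      (ZambonCoisotropic.zambon b E β) ∧
    ZambonCoisotropic.zambon b E (ZambonCoisotropic.negRoot β) =
      ZambonCoisotropic.coisotropicFamily b
        (ZambonCoisotropic.corootLine β) (ZambonCoisotropic.reflectionElt β) 1 ∧
    ZambonCoisotropic.IsCoisotropicLagrangian b c
      (ZambonCoisotropic.lagr b (ZambonCoisotropic.corootLine β)
        (ZambonCoisotropic.reflectionElt β) 1)
      (ZambonCoisotropic.zambon b E (ZambonCoisotropic.negRoot β)) := by
  have hV := corootLine_sup_cartanPerp β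
  have h1 : inversionSet b (1 : (LieAlgebra.IsKilling.rootSystem 𝔥).weylGroup) = ∅ := by rw [inversionSet_eq, sdiff_self]; rfl
  have e1 : zambon b E β = coisotropicFamily b (corootLine β) 1 (reflectionElt β) := by
    rw [coisotropicFamily_eq, zambon_eq b hE hE0 hpos hlong, sdiff_self]
    simp [rootSum]
  have e2 : zambon b E (negRoot β) = coisotropicFamily b (corootLine β) (reflectionElt β) 1 := by
    rw [coisotropicFamily_eq, zambon_negRoot_eq b hE hE0 hpos hlong, sdiff_self]
    simp [rootSum]
  refine ⟨?_, ?_, ?_, e1, ?_, e2, ?_⟩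
  · rw [zambon_eq b hE hE0 hpos hlong, ← iSup_inversionSet]
    exact isInternalDirectSum_corootLine β Subtype.val_injective
  · rw [zambon_negRoot_eq b hE hE0 hpos hlong, ← iSup_negRoot_inversionSet]
    refine isInternalDirectSum_corootLine β fun α γ h => Subtype.ext ?_
    rw [← negRoot_negRoot α.1, ← negRoot_negRoot γ.1]
    exact congrArg negRoot h
  · rw [h1, Set.empty_inter]
  · rw [e1]
    exact isCoisotropicLagrangian_lagr b hc hV (by rw [h1, Set.empty_inter])
  · rw [e2]
    exact isCoisotropicLagrangian_lagr b hc hV (by rw [h1, Set.inter_empty])
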